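/- Conventions. Locally convex spaces are real and Hausdorff. A map $f$ from an open subset $U$ of a locally convex space $X$ to a locally convex space $Y$ is smooth if its iterated directional derivatives $d^kf : U\times X^k\to Y$ exist and are continuous for all $k\ge 0$; on a relatively open subset of a convex set with non-empty interior, $f$ is smooth if it is smooth on the interior and all $d^kf$ extend continuously to the boundary points of the subset. A locally convex manifold is a Hausdorff space with an atlas of charts onto open subsets of a locally convex space (the modelling space) whose coordinate changes are smooth. A $d$-dimensional manifold with corners is a paracompact Hausdorff space with an atlas of charts onto open subsets of $\mathbb{R}^d_+=\{x\in\mathbb{R}^d : x_i\ge 0 \text{ for all } i\}$ whose coordinate changes are smooth. Proposition. Let $M$ be a connected $d$-dimensional manifold with corners ($0\le d<\infty$), let $N$ be a locally convex manifold with modelling space $X$, and let $\pi:E\to M$ be a locally trivial smooth bundle with typical fibre $N$; that is, $E$ is a manifold modelled on $\mathbb{R}^d_+\times X$ and each point of $M$ has an open neighbourhood $B$ with a diffeomorphism $\pi^{-1}(B)\to B\times N$ over $B$. A homotopy between sections $\sigma,\tau$ of $\pi$ is a continuous map $F:[0,1]\times M\to E$ with $F(0,\cdot)=\sigma$, $F(1,\cdot)=\tau$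 and $\pi(F(t,x))=x$ for all $t,x$; it is called smooth if $F$ is smooth on the manifold with corners $[0,1]\times M$. 1. For each continuous section $\sigma$ of $\pi$ there are a smooth section $\tau$ of $\pi$ and a homotopy between $\sigma$ and $\tau$. 2. If $\sigma,\tau$ are smooth sections of $\pi$ and there is a homotopy between them, then there is a smooth homotopy between them. Moreover, let $x_0\in M$ and $e_0\in E$ be base-points with $\pi(e_0)=x_0$. Call a section $\sigma$ base-point preserving if $\sigma(x_0)=e_0$, and a homotopy $F$ base-point preserving if $F(t,x_0)=e_0$ for all $t\in[0,1]$. 3. For each base-point preserving continuous section $\sigma$ there are a base-point preserving smooth section $\tau$ and a base-point preserving homotopy between $\sigma$ and $\tau$. 4. If $\sigma,\tau$ are base-point preserving smooth sections and there is a base-point preserving homotopy between them, then there is a smooth base-point preserving homotopy between them. -/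

import Mathlib

open Set Filter Topology
open scoped Manifold ContDiff

noncomputable section

/-- Smoothness (class `C^∞`) of a map `f` between locally convex spaces on a set `s`.
The function `D k` is the `k`-th differential, `D k x v = d^k f(x).(v₁, …, v_k)`: one has
`d^0 f = f` and
`d^(k+1) f(x).(v₁, …, v_k, w) = lim_{h → 0} (d^k f(x + h w).(v₁, …, v_k) - d^k f(x).(v₁, …, v_k)) / h`
at the interior points `x` of `s`, and all `d^k f` are continuous on `s × V^k`. For open `s` this is
the usual notion. For `s` with dense interior it says that `f` is smooth on the
interior of `s` and that its differentials extend continuously to the boundary points in `s`. -/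
def LCSmoothOn {V W : Type*} [AddCommGroup V] [Module ℝ V] [TopologicalSpace V]
    [AddCommGroup W] [Module ℝ W] [TopologicalSpace W] (f : V → W) (s : Set V) : Prop :=
  ∃ D : (k : ℕ) → V → (Fin k → V) → W,
    (∀ x ∈ s, ∀ v : Fin 0 → V, D 0 x v = f x) ∧
    (∀ k, ContinuousOn (fun p : V × (Fin k → V) => D k p.1 p.2) (s ×ˢ univ)) ∧
    ∀ k, ∀ x ∈ interior s, ∀ (v : Fin k → V) (w : V),
      Tendsto (fun h : ℝ => h⁻¹ • (D k (x + h • w) v - D k x v)) (𝓝[≠] 0)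
        (𝓝 (D (k + 1) x (Fin.snoc (α := fun _ => V) v w)))

/-- A local model `H` for manifolds with corners, embedded into the (real, topological) vector space
`V` as a convex set with non-empty interior: Mathlib's `ModelWithCorners`, without the requirement
that `V` be normed. -/
structure LCModel (V : Type*) [AddCommGroup V] [Module ℝ V] [TopologicalSpace V]
    (H : Type*) [TopologicalSpace H] where
  toFun : H → V
  invFun : V → H
  left_inv : ∀ h, invFun (toFun h) = h
  continuous_toFun : Continuous toFun
  continuous_invFun : Continuous invFun
  convex_range : Convex ℝ (range toFun)
  nonempty_interior : (interior (range toFun)).Nonempty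

namespace LCModel

/-- The model of manifolds without boundary: the whole vector space. -/
def self (V : Type*) [AddCommGroup V] [Module ℝ V] [TopologicalSpace V] : LCModel V V where
  toFun := id
  invFun := id
  left_inv _ := rfl
  continuous_toFun := continuous_id
  continuous_invFun := continuous_id
  convex_range := by simpa using convex_univ
  nonempty_interior := by simp

/-- A model with corners on a normed space. -/
def ofModelWithCorners {V H : Type*} [NormedAddCommGroup V] [NormedSpace ℝ V]
    [TopologicalSpace H] (I : ModelWithCorners ℝ V H) : LCModel V H where
  toFun := I
  invFun := I.symm
  left_inv := I.left_inv
  continuous_toFun := I.continuous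
  continuous_invFun := I.continuous_symm
  convex_range := I.convex_range
  nonempty_interior := I.nonempty_interior

/-- The product of two models. -/
def prod {V H V' H' : Type*} [AddCommGroup V] [Module ℝ V] [TopologicalSpace V]
    [TopologicalSpace H] [AddCommGroup V'] [Module ℝ V'] [TopologicalSpace V']
    [TopologicalSpace H'] (I : LCModel V H) (J : LCModel V' H') :
    LCModel (V × V') (ModelProd H H') where
  toFun p := (I.toFun p.1, J.toFun p.2)
  invFun v := (I.invFun v.1, J.invFun v.2)
  left_inv p := Prod.ext (I.left_inv p.1) (J.left_inv p.2)
  continuous_toFun := I.continuous_toFun.prodMap J.continuous_toFun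
  continuous_invFun := I.continuous_invFun.prodMap J.continuous_invFun
  convex_range := by
    have h : range (fun p : ModelProd H H' => (I.toFun p.1, J.toFun p.2))
        = range I.toFun ×ˢ range J.toFun := range_prodMap
    rw [h]
    exact I.convex_range.prod J.convex_range
  nonempty_interior := by
    have h : range (fun p : ModelProd H H' => (I.toFun p.1, J.toFun p.2))
        = range I.toFun ×ˢ range J.toFun := range_prodMap
    rw [h, interior_prod_eq]
    exact I.nonempty_interior.prod J.nonempty_interior

end LCModel

/-- `P`, with its given atlas, is a smooth manifold (possibly with corners) modelled on the
locally convex space `V` through `I`: the coordinate changes between charts are smooth. -/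
def IsLCManifold {V H : Type*} [AddCommGroup V] [Module ℝ V] [TopologicalSpace V]
    [TopologicalSpace H] (I : LCModel V H) (P : Type*) [TopologicalSpace P] [ChartedSpace H P] :
    Prop :=
  ∀ φ ∈ atlas H P, ∀ φ' ∈ atlas H P,
    LCSmoothOn (fun v => I.toFun (φ' (φ.symm (I.invFun v))))
      (I.toFun '' (φ.target ∩ φ.symm ⁻¹' φ'.source))

/-- `f : P → Q` is smooth on the open set `U`: it is continuous there and all its
coordinate representations are smooth. -/
def LCSmoothMapOn {V H W K : Type*} [AddCommGroup V] [Module ℝ V] [TopologicalSpace V]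
    [TopologicalSpace H] [AddCommGroup W] [Module ℝ W] [TopologicalSpace W] [TopologicalSpace K]
    (I : LCModel V H) (J : LCModel W K) {P Q : Type*}
    [TopologicalSpace P] [ChartedSpace H P] [TopologicalSpace Q] [ChartedSpace K Q]
    (f : P → Q) (U : Set P) : Prop :=
  ContinuousOn f U ∧
    ∀ φ ∈ atlas H P, ∀ ψ ∈ atlas K Q,
      LCSmoothOn (fun v => J.toFun (ψ (f (φ.symm (I.invFun v)))))
        (I.toFun '' (φ.target ∩ φ.symm ⁻¹' (U ∩ f ⁻¹' ψ.source)))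

/-- A smooth map between manifolds. -/
def LCSmoothMap {V H W K : Type*} [AddCommGroup V] [Module ℝ V] [TopologicalSpace V]
    [TopologicalSpace H] [AddCommGroup W] [Module ℝ W] [TopologicalSpace W] [TopologicalSpace K]
    (I : LCModel V H) (J : LCModel W K) {P Q : Type*}
    [TopologicalSpace P] [ChartedSpace H P] [TopologicalSpace Q] [ChartedSpace K Q]
    (f : P → Q) : Prop :=
  LCSmoothMapOn I J f univ

/-- The quadrant `{x ∈ ℝ^d : x_i ≥ 0 for all i}` in `ℝ^d`. -/
def quadrantModel (d : ℕ) : LCModel (EuclideanSpace ℝ (Fin d)) (EuclideanQuadrant d) :=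
  LCModel.ofModelWithCorners (modelWithCornersEuclideanQuadrant d)

/-- The model of the unit interval (the half-line). -/
def intervalModel : LCModel (EuclideanSpace ℝ (Fin 1)) (EuclideanHalfSpace 1) :=
  LCModel.ofModelWithCorners (𝓡∂ 1)

/-- The model of the total space of a bundle over a `d`-dimensional manifold with corners whose
fibre is modelled on `X`. -/
def totalModel (d : ℕ) (X : Type*) [AddCommGroup X] [Module ℝ X] [TopologicalSpace X] :
    LCModel (EuclideanSpace ℝ (Fin d) × X) (ModelProd (EuclideanQuadrant d) X) :=
  (quadrantModel d).prod (LCModel.self X)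

/-- `π : E → M` is a locally trivial smooth bundle with typical fibre `N`: every point of `M` has an
open neighbourhood `B` over which there is a diffeomorphism `π⁻¹(B) → B × N` compatible with the
projections to `B` (smoothness of `π` follows). -/
def IsSmoothBundle (d : ℕ) (X N : Type*) [AddCommGroup X] [Module ℝ X] [TopologicalSpace X]
    [TopologicalSpace N] [ChartedSpace X N] {M E : Type*}
    [TopologicalSpace M] [ChartedSpace (EuclideanQuadrant d) M]
    [TopologicalSpace E] [ChartedSpace (ModelProd (EuclideanQuadrant d) X) E]
    (π : E → M) : Prop :=
  ∀ x : M, ∃ e : Bundle.Trivialization N π, x ∈ e.baseSet ∧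
    LCSmoothMapOn (totalModel d X) ((quadrantModel d).prod (LCModel.self X))
      e.toOpenPartialHomeomorph e.source ∧
    LCSmoothMapOn ((quadrantModel d).prod (LCModel.self X)) (totalModel d X)
      e.toOpenPartialHomeomorph.symm e.target

/-- `σ` is a (not necessarily continuous) section of `π`. -/
def IsSection {M E : Type*} (π : E → M) (σ : M → E) : Prop :=
  ∀ x, π (σ x) = x

/-- `F` is a continuous homotopy between the sections `σ` and `τ` of `π`, through sections. -/
structure IsSectionHomotopy {M E : Type*} [TopologicalSpace M] [TopologicalSpace E]
    (π : E → M) (σ τ : M → E) (F : unitInterval × M → E) : Prop where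
  continuous : Continuous F
  isSection : ∀ t, IsSection π (fun x => F (t, x))
  zero : ∀ x, F (0, x) = σ x
  one : ∀ x, F (1, x) = τ x

/-- Smoothness of a map `M → E` into the total space of a bundle over `M`. -/
def IsSmoothInto (d : ℕ) (X : Type*) [AddCommGroup X] [Module ℝ X] [TopologicalSpace X]
    {M E : Type*} [TopologicalSpace M] [ChartedSpace (EuclideanQuadrant d) M]
    [TopologicalSpace E] [ChartedSpace (ModelProd (EuclideanQuadrant d) X) E]
    (σ : M → E) : Prop :=
  LCSmoothMap (quadrantModel d) (totalModel d X) σ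

/-- Smoothness of a map `[0,1] × M → E` on the manifold with corners `[0,1] × M`. -/
def IsSmoothHomotopy (d : ℕ) (X : Type*) [AddCommGroup X] [Module ℝ X] [TopologicalSpace X]
    {M E : Type*} [TopologicalSpace M] [ChartedSpace (EuclideanQuadrant d) M]
    [TopologicalSpace E] [ChartedSpace (ModelProd (EuclideanQuadrant d) X) E]
    (F : unitInterval × M → E) : Prop :=
  LCSmoothMap (intervalModel.prod (quadrantModel d)) (totalModel d X) F

end

set_option linter.unusedSectionVars false

/-! All four statements follow from one relative smoothing theorem, `exists_smooth_lift`: a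
continuous lift through `π` of a map `p : B → M` can be changed, off a closed set `A`, so as to
become smooth on `S`, provided its values on `A` have local extensions to lifts smooth on `S`. It is
used for the projection of `B = [0,1] × M` to `M`. To smooth a section, start with the homotopy
constant in time, keep it fixed on `{0} × M` and on the line over the base-point, make it smooth for
`t > 1/2`, and read off the new section at `t = 1`. To smooth a homotopy, keep `{1} × M` fixed as
well and smooth everywhere; near the two ends the given smooth sections, constant in time, are the
local extensions, so no reparametrization of time is needed.

The smoothing proceeds one chart at a time. In a trivialization combined with a chart of `N`
(`FibreChart`) the lift becomes an `X`-valued map `f`. On the compact support of a bump function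
`χ`, a partition of unity yields a smooth `g` with `g - f` in a prescribed convex neighbourhood of
zero (`exists_smooth_approx`), and `f` is replaced by `f + χ • (g - f)`
(`FibreChart.exists_smoothing`). At points of `S` existing smoothness is preserved, and smoothness
is gained where `χ` is locally `1`. The convex neighbourhood comes from compactness, so no metric on
`X` or `E` is involved. As `B` is σ-compact, countably many locally finite steps suffice, and the
sequence of lifts is locally stationary.

The calculus is needed because `X` is an arbitrary locally convex space. The maps to be constructed
have finite-dimensional domain, so their smoothness is handled through partial derivatives
(`FSmoothOn`); the chain rule `LCSmoothOn.comp_fSmoothOn` links this to iterated differentials, and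
lets charts and trivializations act on such maps. -/

noncomputable section

/-! ### Iterated differentials between locally convex spaces -/

section Calculus

variable {W Z : Type*} [AddCommGroup W] [Module ℝ W] [TopologicalSpace W]
  [AddCommGroup Z] [Module ℝ Z] [TopologicalSpace Z]

/-- Every neighbourhood in a locally convex space contains a closed convex one. -/
theorem exists_isClosed_convex_nhds [IsTopologicalAddGroup Z] [ContinuousSMul ℝ Z]
    [LocallyConvexSpace ℝ Z] {z : Z} {U : Set Z} (hU : U ∈ 𝓝 z) :
    ∃ N ∈ 𝓝 z, IsClosed N ∧ Convex ℝ N ∧ N ⊆ U := by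
  obtain ⟨T, ⟨hT, hTc⟩, hTU⟩ := (closed_nhds_basis z).mem_iff.1 hU
  obtain ⟨S, ⟨hS, hSc⟩, hST⟩ := (LocallyConvexSpace.convex_basis (𝕜 := ℝ) z).mem_iff.1 hT
  exact ⟨closure S, mem_of_superset hS subset_closure, isClosed_closure, hSc.closure,
    (closure_minimal hST hTc).trans hTU⟩

/-- Mean value theorem: an increment lies in each closed convex set containing the derivatives. -/
theorem sub_mem_of_derivative_mem [IsTopologicalAddGroup Z] [ContinuousSMul ℝ Z]
    [LocallyConvexSpace ℝ Z] {γ γ' : ℝ → Z} {N : Set Z} (hN : Convex ℝ N) (hNc : IsClosed N)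
    (hγ : ContinuousOn γ (Icc 0 1))
    (hd : ∀ τ ∈ Ioo (0 : ℝ) 1,
      Tendsto (fun k : ℝ => k⁻¹ • (γ (τ + k) - γ τ)) (𝓝[≠] 0) (𝓝 (γ' τ)))
    (hm : ∀ τ ∈ Ioo (0 : ℝ) 1, γ' τ ∈ N) : γ 1 - γ 0 ∈ N := by
  by_contra hn
  -- A functional separating the increment from `N` reduces the claim to the scalar mean value
  -- theorem.
  obtain ⟨l, u, h1, h2⟩ := geometric_hahn_banach_closed_point hN hNc hn
  obtain ⟨τ, hτ, he⟩ := exists_hasDerivAt_eq_slope (fun t => l (γ t)) (fun t => l (γ' t))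
    zero_lt_one (l.continuous.comp_continuousOn hγ) (fun τ hτ => by
      rw [hasDerivAt_iff_tendsto_slope_zero]
      refine ((l.continuous.tendsto _).comp (hd τ hτ)).congr fun k => ?_
      simp [map_sub])
  have := h1 _ (hm τ hτ)
  rw [he] at this
  simp only [sub_zero, div_one, ← map_sub] at this
  exact lt_asymm this h2

/-- `D` is a system of iterated differentials on `s`, as in `LCSmoothOn`. -/
structure IsDifferentials (D : (k : ℕ) → W → (Fin k → W) → Z) (s : Set W) : Prop where
  continuousOn : ∀ k, ContinuousOn (fun p : W × (Fin k → W) => D k p.1 p.2) (s ×ˢ univ)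
  tendsto : ∀ k, ∀ x ∈ interior s, ∀ (v : Fin k → W) (w : W),
      Tendsto (fun h : ℝ => h⁻¹ • (D k (x + h • w) v - D k x v)) (𝓝[≠] 0)
        (𝓝 (D (k + 1) x (Fin.snoc (α := fun _ => W) v w)))

theorem lcSmoothOn_iff {f : W → Z} {s : Set W} :
    LCSmoothOn f s ↔ ∃ D, (∀ x ∈ s, ∀ v : Fin 0 → W, D 0 x v = f x) ∧ IsDifferentials D s :=
  ⟨fun ⟨D, h0, h1, h2⟩ => ⟨D, h0, h1, h2⟩, fun ⟨D, h0, h1⟩ => ⟨D, h0, h1.1, h1.2⟩⟩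

/-- Relatively open subsets of convex sets with non-empty interior. -/
def IsConvexCornered (s : Set W) : Prop :=
  ∃ O R : Set W, IsOpen O ∧ Convex ℝ R ∧ (interior R).Nonempty ∧ s = O ∩ R

theorem IsConvexCornered.inter_left {s O : Set W} (hs : IsConvexCornered s) (hO : IsOpen O) :
    IsConvexCornered (O ∩ s) := by
  obtain ⟨O', R, h1, h2, h3, rfl⟩ := hs
  exact ⟨O ∩ O', R, hO.inter h1, h2, h3, (inter_assoc _ _ _).symm⟩

section Closure
variable [IsTopologicalAddGroup W] [ContinuousSMul ℝ W]

theorem IsConvexCornered.subset_closure_interior {s : Set W} (hs : IsConvexCornered s) :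
    s ⊆ closure (interior s) := by
  obtain ⟨O, R, hO, hR, hne, rfl⟩ := hs
  rintro x ⟨hxO, hxR⟩
  rw [interior_inter, hO.interior_eq]
  apply hO.inter_closure
  exact ⟨hxO, by rw [hR.closure_interior_eq_closure_of_nonempty_interior hne]
                 exact subset_closure hxR⟩

/-- Continuous maps agree on `s` if they agree on its interior. -/
theorem IsConvexCornered.eqOn_of_interior {Y : Type*} [TopologicalSpace Y] [T2Space Y]
    {s : Set W} (hs : IsConvexCornered s) {f g : W → Y}
    (hf : ContinuousOn f s) (hg : ContinuousOn g s) (h : EqOn f g (interior s)) : EqOn f g s :=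
  h.of_subset_closure hf hg interior_subset hs.subset_closure_interior

/-- Segments between nearby points must stay in the set for the mean value theorem. The interior
survives the intersection with a small convex set because `x` is a limit of interior points. -/
theorem IsConvexCornered.exists_convex_nhds [LocallyConvexSpace ℝ W]
    {s : Set W} (hs : IsConvexCornered s) {x : W} (hx : x ∈ s) {U : Set W} (hU : U ∈ 𝓝[s] x) :
    ∃ R ∈ 𝓝[s] x, Convex ℝ R ∧ (interior R).Nonempty ∧ R ⊆ U ∧ R ⊆ s := by
  obtain ⟨O, R, hO, hR, hne, rfl⟩ := hs
  obtain ⟨u, hu, huU⟩ := mem_nhdsWithin_iff_exists_mem_nhds_inter.1 hU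
  obtain ⟨C, ⟨hC, hCc⟩, hCu⟩ := (LocallyConvexSpace.convex_basis (𝕜 := ℝ) x).mem_iff.1
    (inter_mem hu (hO.mem_nhds hx.1))
  refine ⟨C ∩ R, ?_, hCc.inter hR, ?_, ?_, ?_⟩
  · rw [mem_nhdsWithin_iff_exists_mem_nhds_inter]
    exact ⟨C, hC, fun z hz => ⟨hz.1, hz.2.2⟩⟩
  · rw [interior_inter]
    have : x ∈ closure (interior R) := by
      rw [hR.closure_interior_eq_closure_of_nonempty_interior hne]
      exact subset_closure hx.2
    exact mem_closure_iff.1 this _ isOpen_interior (mem_interior_iff_mem_nhds.2 hC)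
  · exact fun z hz => huU ⟨(hCu hz.1).1, (hCu hz.1).2, hz.2⟩
  · exact fun z hz => ⟨(hCu hz.1).2, hz.2⟩

end Closure

namespace IsDifferentials

variable [IsTopologicalAddGroup W] [ContinuousSMul ℝ W] [IsTopologicalAddGroup Z]
  [ContinuousSMul ℝ Z] [LocallyConvexSpace ℝ Z]
  {D : (k : ℕ) → W → (Fin k → W) → Z} {s : Set W}

theorem continuousOn_left (hD : IsDifferentials D s) (k : ℕ) (v : Fin k → W) :
    ContinuousOn (fun x => D k x v) s :=
  (hD.continuousOn k).comp (f := fun x => (x, v)) (by fun_prop) fun x hx => ⟨hx, mem_univ _⟩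

/-- Mean value theorem on the segment from `y` to `y + h • δ`. Its velocity is `h • δ`, and the
factor `h⁻¹` on the curve leaves exactly the derivative in direction `δ`. -/
theorem slope_mem_of_interior (hD : IsDifferentials D s) {R : Set W}
    (hR : Convex ℝ R) (hRs : R ⊆ interior s) {N : Set Z} (hN : Convex ℝ N) (hNc : IsClosed N)
    {k : ℕ} {y δ : W} {h : ℝ} (hh : h ≠ 0) (v : Fin k → W) (hy : y ∈ R) (hy' : y + h • δ ∈ R)
    (hm : ∀ z ∈ R, D (k + 1) z (Fin.snoc (α := fun _ => W) v δ) ∈ N) :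
    h⁻¹ • (D k (y + h • δ) v - D k y v) ∈ N := by
  have hmem : ∀ τ ∈ Icc (0 : ℝ) 1, y + τ • (h • δ) ∈ R := fun τ hτ =>
    hR.add_smul_mem hy hy' hτ
  have := sub_mem_of_derivative_mem (γ := fun τ => h⁻¹ • D k (y + τ • (h • δ)) v)
    (γ' := fun τ => D (k + 1) (y + τ • (h • δ)) (Fin.snoc (α := fun _ => W) v δ)) hN hNc ?_ ?_ ?_
  · simpa [smul_sub] using this
  · refine ContinuousOn.const_smul ?_ _
    exact (hD.continuousOn_left k v).comp (by fun_prop)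
      fun τ hτ => interior_subset (hRs (hmem τ hτ))
  · intro τ hτ
    have h1 := hD.tendsto k _ (hRs (hmem τ (Ioo_subset_Icc_self hτ))) v δ
    have h2 : Tendsto (fun t : ℝ => t * h) (𝓝[≠] 0) (𝓝[≠] 0) := by
      refine tendsto_nhdsWithin_iff.2 ⟨?_, ?_⟩
      · have : Tendsto (fun t : ℝ => t * h) (𝓝 0) (𝓝 (0 * h)) := (continuous_mul_const h).tendsto 0
        rw [zero_mul] at this
        exact this.mono_left nhdsWithin_le_nhds
      · filter_upwards [self_mem_nhdsWithin] with t ht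
        exact mul_ne_zero ht hh
    refine (h1.comp h2).congr fun t => ?_
    simp only [Function.comp, smul_sub, mul_inv, add_smul, mul_smul, add_assoc]
  · exact fun τ hτ => hm _ (hmem τ (Ioo_subset_Icc_self hτ))

/-- Contracting the segment towards an interior point `c` puts it inside the interior while keeping
the direction `δ`; as the contraction tends to the identity, closedness of `N` gives the claim up to
the boundary. -/
theorem slope_mem (hD : IsDifferentials D s) {R : Set W}
    (hR : Convex ℝ R) (hne : (interior R).Nonempty) (hRs : R ⊆ s)
    {N : Set Z} (hN : Convex ℝ N) (hNc : IsClosed N)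
    {k : ℕ} {y δ : W} {h : ℝ} (hh : h ≠ 0) (v : Fin k → W) (hy : y ∈ R) (hy' : y + h • δ ∈ R)
    (hm : ∀ z ∈ R, D (k + 1) z (Fin.snoc (α := fun _ => W) v δ) ∈ N) :
    h⁻¹ • (D k (y + h • δ) v - D k y v) ∈ N := by
  obtain ⟨c, hc⟩ := hne
  have key : ∀ z ∈ R, Tendsto (fun ε : ℝ => D k (ε • c + (1 - ε) • z) v) (𝓝[>] 0)
      (𝓝 (D k z v)) := by
    intro z hz
    have h1 : Tendsto (fun ε : ℝ => ε • c + (1 - ε) • z) (𝓝[>] 0) (𝓝[s] z) := by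
      refine tendsto_nhdsWithin_iff.2 ⟨?_, ?_⟩
      · have : Tendsto (fun ε : ℝ => ε • c + (1 - ε) • z) (𝓝 0)
            (𝓝 ((0 : ℝ) • c + (1 - 0 : ℝ) • z)) := by
          apply Continuous.tendsto (f := fun ε : ℝ => ε • c + (1 - ε) • z)
          fun_prop
        simp only [zero_smul, sub_zero, one_smul, zero_add] at this
        exact this.mono_left nhdsWithin_le_nhds
      · filter_upwards [Ioo_mem_nhdsGT (zero_lt_one (α := ℝ))] with ε hε
        exact hRs (hR (interior_subset hc) hz hε.1.le (by linarith [hε.2]) (by ring))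
    exact (hD.continuousOn_left k v z (hRs hz)).tendsto.comp h1
  have hlim : Tendsto (fun ε : ℝ => ((1 - ε) * h)⁻¹ •
      (D k (ε • c + (1 - ε) • (y + h • δ)) v - D k (ε • c + (1 - ε) • y) v)) (𝓝[>] 0)
      (𝓝 (h⁻¹ • (D k (y + h • δ) v - D k y v))) := by
    refine Tendsto.smul ?_ ((key _ hy').sub (key _ hy))
    have : ContinuousAt (fun ε : ℝ => ((1 - ε) * h)⁻¹) 0 :=
      ContinuousAt.inv₀ (by fun_prop) (by simpa using hh)
    have h2 := this.tendsto
    simp only [sub_zero, one_mul] at h2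
    exact h2.mono_left nhdsWithin_le_nhds
  refine hNc.mem_of_tendsto hlim ?_
  filter_upwards [Ioo_mem_nhdsGT (zero_lt_one (α := ℝ))] with ε hε
  have hint : ∀ z ∈ R, ε • c + (1 - ε) • z ∈ interior R := fun z hz =>
    hR.combo_interior_self_mem_interior hc hz hε.1 (by linarith [hε.2]) (by ring)
  have e : ε • c + (1 - ε) • (y + h • δ) = (ε • c + (1 - ε) • y) + ((1 - ε) * h) • δ := by
    rw [smul_add, mul_smul, add_assoc]
  have h3 := hint _ hy'
  rw [e] at h3 ⊢
  exact hD.slope_mem_of_interior hR.interior (interior_mono hRs) hN hNc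
    (mul_ne_zero (by linarith [hε.2]) hh) v (hint _ hy) h3 fun z hz => hm z (interior_subset hz)

/-- Convergence of difference quotients with varying base point, direction and arguments. -/
theorem tendsto_slope [LocallyConvexSpace ℝ W] (hD : IsDifferentials D s)
    (hs : IsConvexCornered s) {α : Type*} {l : Filter α} {k : ℕ} {x w : W} (hx : x ∈ s)
    {y δ : α → W} {h : α → ℝ} {v : α → Fin k → W} {v₀ : Fin k → W}
    (hh : ∀ᶠ a in l, h a ≠ 0) (hy : Tendsto y l (𝓝[s] x))
    (hy' : Tendsto (fun a => y a + h a • δ a) l (𝓝[s] x)) (hδ : Tendsto δ l (𝓝 w))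
    (hv : Tendsto v l (𝓝 v₀)) :
    Tendsto (fun a => (h a)⁻¹ • (D k (y a + h a • δ a) (v a) - D k (y a) (v a))) l
      (𝓝 (D (k + 1) x (Fin.snoc (α := fun _ => W) v₀ w))) := by
  intro U hU
  obtain ⟨N, hN, hNc, hNconv, hNU⟩ := exists_isClosed_convex_nhds hU
  have hcont : Tendsto (fun p : W × ((Fin k → W) × W) =>
      D (k + 1) p.1 (Fin.snoc (α := fun _ => W) p.2.1 p.2.2)) (𝓝[s] x ×ˢ 𝓝 (v₀, w))
      (𝓝 (D (k + 1) x (Fin.snoc (α := fun _ => W) v₀ w))) := by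
    have h1 : Continuous (fun p : W × ((Fin k → W) × W) =>
        (p.1, (Fin.snoc (α := fun _ => W) p.2.1 p.2.2 : Fin (k + 1) → W))) := by
      refine continuous_fst.prodMk (continuous_pi fun i => ?_)
      refine Fin.lastCases ?_ (fun j => ?_) i
      · simpa using continuous_snd.snd
      · simp only [Fin.snoc_castSucc]
        fun_prop
    have h2 : ContinuousOn (fun p : W × ((Fin k → W) × W) =>
        D (k + 1) p.1 (Fin.snoc (α := fun _ => W) p.2.1 p.2.2)) (s ×ˢ univ) :=
      (hD.continuousOn (k + 1)).comp h1.continuousOn fun p hp => ⟨hp.1, mem_univ _⟩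
    have h3 := h2 (x, (v₀, w)) ⟨hx, mem_univ _⟩
    rwa [ContinuousWithinAt, nhdsWithin_prod_eq, nhdsWithin_univ] at h3
  obtain ⟨A, hA, B, hB, hAB⟩ := mem_prod_iff.1 (hcont hN)
  obtain ⟨R, hR, hRc, hRi, hRA, hRs⟩ := hs.exists_convex_nhds hx hA
  have hvδ : ∀ᶠ a in l, (v a, δ a) ∈ B := (hv.prodMk_nhds hδ).eventually_mem hB
  have hmem : ∀ᶠ a in l, y a ∈ R := hy.eventually_mem hR
  have hmem' : ∀ᶠ a in l, y a + h a • δ a ∈ R := hy'.eventually_mem hR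
  rw [mem_map]
  filter_upwards [hh, hmem, hmem', hvδ] with a h1 h2 h3 h4
  exact hNU (hD.slope_mem hRc hRi hRs hNconv hNc h1 (v a) h2 h3
    fun z hz => hAB (mk_mem_prod (hRA hz) h4))

/-- The slope along `w + w'` is the slope along `w` at `x` plus the slope along `w'` at the moving
point `x + h • w`; `tendsto_slope` allows the moving base point. -/
theorem snoc_add [LocallyConvexSpace ℝ W] [T2Space Z] (hD : IsDifferentials D s)
    (hs : IsConvexCornered s) {k : ℕ} {x : W} (hx : x ∈ interior s) (v : Fin k → W) (w w' : W) :
    D (k + 1) x (Fin.snoc (α := fun _ => W) v (w + w')) =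
      D (k + 1) x (Fin.snoc (α := fun _ => W) v w) +
        D (k + 1) x (Fin.snoc (α := fun _ => W) v w') := by
  have hlim : ∀ u : W, Tendsto (fun h : ℝ => x + h • u) (𝓝[≠] 0) (𝓝[s] x) := by
    intro u
    have : Tendsto (fun h : ℝ => x + h • u) (𝓝 0) (𝓝 (x + (0 : ℝ) • u)) := by
      apply Continuous.tendsto (f := fun h : ℝ => x + h • u)
      fun_prop
    rw [zero_smul, add_zero] at this
    rw [nhdsWithin_eq_nhds.2 (mem_interior_iff_mem_nhds.1 hx)]
    exact this.mono_left nhdsWithin_le_nhds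
  have h1 := hD.tendsto k x hx v (w + w')
  have h2 := hD.tendsto k x hx v w
  have h3 := hD.tendsto_slope hs (interior_subset hx) (l := 𝓝[≠] (0 : ℝ)) (v := fun _ => v)
    (h := id) (δ := fun _ => w') (y := fun h => x + h • w) self_mem_nhdsWithin (hlim w)
    ((hlim (w + w')).congr fun h => by simp [smul_add, add_assoc]) tendsto_const_nhds
    tendsto_const_nhds
  refine tendsto_nhds_unique h1 ((h2.add h3).congr fun h => ?_)
  simp only [id, ← smul_add, add_assoc]
  congr 1
  abel

/-- On the interior by induction: the last slot is `snoc_add`, and additivity in an earlier slot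
passes through the difference quotients. Continuity extends it to the boundary. -/
theorem update_add [LocallyConvexSpace ℝ W] [T2Space Z] (hD : IsDifferentials D s)
    (hs : IsConvexCornered s) {k : ℕ} {x : W} (hx : x ∈ s) (v : Fin k → W) (i : Fin k)
    (a b : W) :
    D k x (Function.update v i (a + b)) =
      D k x (Function.update v i a) + D k x (Function.update v i b) := by
  refine hs.eqOn_of_interior (hD.continuousOn_left k _)
    ((hD.continuousOn_left k _).add (hD.continuousOn_left k _)) ?_ hx
  clear hx x
  induction k with
  | zero => exact i.elim0
  | succ k ih =>
    intro x hx
    rw [← Fin.snoc_init_self v]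
    refine Fin.lastCases ?_ (fun j => ?_) i
    · simp only [Fin.update_snoc_last]
      exact hD.snoc_add hs hx _ a b
    · simp only [← Fin.snoc_update]
      refine tendsto_nhds_unique (hD.tendsto k x hx _ _)
        (((hD.tendsto k x hx _ _).add (hD.tendsto k x hx _ _)).congr' ?_)
      have : ∀ᶠ h : ℝ in 𝓝[≠] 0, x + h • v (Fin.last k) ∈ interior s := by
        have h1 : ContinuousAt (fun h : ℝ => x + h • v (Fin.last k)) 0 := by fun_prop
        refine nhdsWithin_le_nhds (h1.eventually_mem (isOpen_interior.mem_nhds ?_))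
        simpa using hx
      filter_upwards [this] with h hh
      have e1 := ih (Fin.init v) j hh
      have e2 := ih (Fin.init v) j hx
      simp only [Pi.add_apply] at e1 e2
      rw [← smul_add, e1, e2]
      congr 1
      abel

theorem continuous_right (hD : IsDifferentials D s) {k : ℕ} {x : W} (hx : x ∈ s) :
    Continuous (D k x) := by
  rw [← continuousOn_univ]
  exact (hD.continuousOn k).comp (f := fun v => (x, v)) (by fun_prop) fun v _ => ⟨hx, mem_univ _⟩

/-- The differentials at a point, as multilinear maps. -/
def multilinear [LocallyConvexSpace ℝ W] [T2Space Z] (hD : IsDifferentials D s)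
    (hs : IsConvexCornered s) {x : W} (hx : x ∈ s) (k : ℕ) :
    MultilinearMap ℝ (fun _ : Fin k => W) Z :=
  MultilinearMap.mk' (D k x) (fun v i a b => hD.update_add hs hx v i a b) (fun v i c a => by
    -- Homogeneity is automatic: a continuous additive map between real topological vector spaces is
    -- linear.
    let A : W →+ Z := AddMonoidHom.mk' (fun a => D k x (Function.update v i a))
      fun a b => hD.update_add hs hx v i a b
    exact map_real_smul A ((hD.continuous_right hx).comp (by fun_prop)) c a)

end IsDifferentials

/-- The derivative of a continuous multilinear map along curves with given derivatives. -/
theorem MultilinearMap.tendsto_slope {k : ℕ} [IsTopologicalAddGroup W] [ContinuousSMul ℝ W]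
    [IsTopologicalAddGroup Z]
    (m : MultilinearMap ℝ (fun _ : Fin k => W) Z)
    (hm : Continuous m) {α : Type*} {l : Filter α} {h : α → ℝ} {v : α → Fin k → W}
    {v₀ w : Fin k → W} (hv : Tendsto v l (𝓝 v₀))
    (hw : Tendsto (fun a => (h a)⁻¹ • (v a - v₀)) l (𝓝 w)) :
    Tendsto (fun a => (h a)⁻¹ • (m (v a) - m v₀)) l
      (𝓝 (∑ i, m (Function.update v₀ i (w i)))) := by
  -- Telescoping: slots before `i` already carry `v a`, slots after `i` still carry `v₀`.
  have key : ∀ a, (h a)⁻¹ • (m (v a) - m v₀) = ∑ i : Fin k, m (Function.update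
      (fun j => if j < i then v a j else v₀ j) i (((h a)⁻¹ • (v a - v₀)) i)) := by
    intro a
    have := m.map_piecewise_sub_map_piecewise (v a) v₀ (fun _ => 0) Finset.univ
    simp only [Finset.piecewise_univ, Finset.mem_univ] at this
    rw [this, Finset.smul_sum]
    refine Finset.sum_congr rfl fun i _ => ?_
    rw [Pi.smul_apply, m.map_update_smul]
    congr 2
    ext j
    rcases lt_trichotomy j i with hj | rfl | hj
    · simp [hj, hj.ne]
    · simp
    · simp [hj.ne', hj.not_gt]
  simp_rw [key]
  refine tendsto_finsetSum _ fun i _ => (hm.tendsto _).comp ?_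
  rw [tendsto_pi_nhds] at hv hw ⊢
  intro j
  by_cases hj : j = i
  · subst hj
    simpa using hw j
  · simp only [Function.update_of_ne hj]
    split_ifs
    · exact hv j
    · exact tendsto_const_nhds

end Calculus

/-! ### Smooth maps with finite-dimensional domain -/

section FiniteDimensional

variable {V W Z : Type*} [NormedAddCommGroup V] [NormedSpace ℝ V] [FiniteDimensional ℝ V]
  [AddCommGroup W] [Module ℝ W] [TopologicalSpace W]
  [AddCommGroup Z] [Module ℝ Z] [TopologicalSpace Z]

/-- `f'` are the partial derivatives of `f` at the interior points of `s`, with respect to the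
coordinates of a fixed basis. -/
def HasPartials (f : V → W) (f' : Fin (Module.finrank ℝ V) → V → W) (s : Set V) : Prop :=
  ∀ x ∈ interior s, ∀ w : V, Tendsto (fun h : ℝ => h⁻¹ • (f (x + h • w) - f x)) (𝓝[≠] 0)
    (𝓝 (∑ i, (Module.finBasis ℝ V).repr w i • f' i x))

/-- Smoothness of a map on a subset of a finite-dimensional space, expressed coinductively:
`f` belongs to a class of continuous maps which is closed under forming partial derivatives. -/
def FSmoothOn (f : V → W) (s : Set V) : Prop :=
  ∃ 𝒜 : Set (V → W), f ∈ 𝒜 ∧ ∀ g ∈ 𝒜, ContinuousOn g s ∧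
    ∃ g' : Fin (Module.finrank ℝ V) → V → W, (∀ i, g' i ∈ 𝒜) ∧ HasPartials g g' s

theorem tendsto_add_smul_nhdsWithin {s : Set V} {x : V} (hx : x ∈ interior s) (w : V) :
    Tendsto (fun h : ℝ => x + h • w) (𝓝[≠] 0) (𝓝[s] x) := by
  rw [nhdsWithin_eq_nhds.2 (mem_interior_iff_mem_nhds.1 hx)]
  have : ContinuousAt (fun h : ℝ => x + h • w) 0 := by fun_prop
  have h2 := this.tendsto
  rw [zero_smul, add_zero] at h2
  exact h2.mono_left nhdsWithin_le_nhds

theorem HasPartials.congr {f g : V → W} {f' : Fin (Module.finrank ℝ V) → V → W} {s : Set V}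
    (h : HasPartials f f' s) (hfg : EqOn f g s) : HasPartials g f' s := by
  intro x hx w
  refine (h x hx w).congr' ?_
  filter_upwards [(tendsto_add_smul_nhdsWithin hx w).eventually_mem self_mem_nhdsWithin] with t ht
  rw [hfg ht, hfg (interior_subset hx)]

theorem HasPartials.mono {f : V → W} {f' : Fin (Module.finrank ℝ V) → V → W} {s t : Set V}
    (h : HasPartials f f' s) (hts : t ⊆ s) : HasPartials f f' t :=
  fun x hx => h x (interior_mono hts hx)

theorem HasPartials.eqOn [T2Space W] {f : V → W} {f' f'' : Fin (Module.finrank ℝ V) → V → W}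
    {s : Set V} (h : HasPartials f f' s) (h' : HasPartials f f'' s)
    (i : Fin (Module.finrank ℝ V)) : EqOn (f' i) (f'' i) (interior s) := by
  intro x hx
  simpa [Finsupp.single_apply] using tendsto_nhds_unique
    (h x hx (Module.finBasis ℝ V i)) (h' x hx (Module.finBasis ℝ V i))

theorem HasPartials.add [IsTopologicalAddGroup W] {f g : V → W}
    {f' g' : Fin (Module.finrank ℝ V) → V → W}
    {s : Set V} (h : HasPartials f f' s) (h' : HasPartials g g' s) :
    HasPartials (f + g) (f' + g') s := by
  intro x hx w
  simp only [Pi.add_apply, smul_add, Finset.sum_add_distrib]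
  refine ((h x hx w).add (h' x hx w)).congr fun t => ?_
  rw [← smul_add]
  congr 1
  abel

namespace FSmoothOn

theorem continuousOn {f : V → W} {s : Set V} (h : FSmoothOn f s) : ContinuousOn f s :=
  let ⟨_, hf, h⟩ := h; (h f hf).1

theorem exists_hasPartials {f : V → W} {s : Set V} (h : FSmoothOn f s) :
    ∃ f' : Fin (Module.finrank ℝ V) → V → W, (∀ i, FSmoothOn (f' i) s) ∧ HasPartials f f' s :=
  let ⟨𝒜, hf, h⟩ := h
  let ⟨_, f', h1, h2⟩ := h f hf
  ⟨f', fun i => ⟨𝒜, h1 i, h⟩, h2⟩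

theorem mono {f : V → W} {s t : Set V} (h : FSmoothOn f s) (hts : t ⊆ s) : FSmoothOn f t := by
  obtain ⟨𝒜, hf, h⟩ := h
  refine ⟨𝒜, hf, fun g hg => ?_⟩
  obtain ⟨h1, g', h2, h3⟩ := h g hg
  exact ⟨h1.mono hts, g', h2, h3.mono hts⟩

/-- The class of all smooth maps is itself closed under partial derivatives, and adjoining `f` keeps
it so. -/
theorem of_partials {f : V → W} {f' : Fin (Module.finrank ℝ V) → V → W} {s : Set V}
    (hf : ContinuousOn f s) (h : HasPartials f f' s) (hf' : ∀ i, FSmoothOn (f' i) s) :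
    FSmoothOn f s := by
  refine ⟨insert f {g | FSmoothOn g s}, mem_insert _ _, ?_⟩
  rintro g (rfl | hg)
  · exact ⟨hf, f', fun i => Or.inr (hf' i), h⟩
  · obtain ⟨g', h1, h2⟩ := FSmoothOn.exists_hasPartials hg
    exact ⟨FSmoothOn.continuousOn hg, g', fun i => Or.inr (h1 i), h2⟩

theorem congr {f g : V → W} {s : Set V} (h : FSmoothOn f s) (hfg : EqOn f g s) :
    FSmoothOn g s := by
  obtain ⟨f', h1, h2⟩ := h.exists_hasPartials
  exact of_partials (h.continuousOn.congr hfg.symm) (h2.congr hfg) h1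

/-- It is enough that the partial derivatives are sums of members of the class. -/
theorem of_closure [IsTopologicalAddGroup W] {s : Set V} {𝒜 : Set (V → W)}
    (h : ∀ g ∈ 𝒜, ContinuousOn g s ∧ ∃ g' : Fin (Module.finrank ℝ V) → V → W,
      (∀ i, g' i ∈ AddSubmonoid.closure 𝒜) ∧ HasPartials g g' s)
    {f : V → W} (hf : f ∈ AddSubmonoid.closure 𝒜) : FSmoothOn f s := by
  refine ⟨AddSubmonoid.closure 𝒜, hf, fun g hg => ?_⟩
  induction hg using AddSubmonoid.closure_induction with
  | mem g hg => exact h g hg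
  | zero =>
    refine ⟨continuousOn_const, 0, fun i => zero_mem _, fun x _ w => ?_⟩
    simpa using tendsto_const_nhds
  | add f g _ _ hf hg =>
    obtain ⟨hf, f', hf', hf''⟩ := hf
    obtain ⟨hg, g', hg', hg''⟩ := hg
    exact ⟨hf.add hg, f' + g', fun i => add_mem (hf' i) (hg' i), hf''.add hg''⟩

theorem add [IsTopologicalAddGroup W] {s : Set V} {f g : V → W} (hf : FSmoothOn f s)
    (hg : FSmoothOn g s) : FSmoothOn (f + g) s := by
  refine of_closure (𝒜 := {f | FSmoothOn f s}) (fun g hg => ?_)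
    (add_mem (AddSubmonoid.subset_closure hf) (AddSubmonoid.subset_closure hg))
  obtain ⟨g', h1, h2⟩ := FSmoothOn.exists_hasPartials hg
  exact ⟨FSmoothOn.continuousOn hg, g', fun i => AddSubmonoid.subset_closure (h1 i), h2⟩

theorem const (c : W) (s : Set V) : FSmoothOn (fun _ => c) s := by
  refine ⟨{f | ∃ c, f = fun _ => c}, ⟨c, rfl⟩, ?_⟩
  rintro _ ⟨c, rfl⟩
  exact ⟨continuousOn_const, 0, fun i => ⟨0, rfl⟩, fun x _ w => by simpa using tendsto_const_nhds⟩

theorem prodMk {s : Set V} {f : V → W} {g : V → Z} (hf : FSmoothOn f s) (hg : FSmoothOn g s) :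
    FSmoothOn (fun x => (f x, g x)) s := by
  refine ⟨{F | ∃ f g, FSmoothOn f s ∧ FSmoothOn g s ∧ F = fun x => (f x, g x)},
    ⟨f, g, hf, hg, rfl⟩, ?_⟩
  rintro _ ⟨f, g, hf, hg, rfl⟩
  obtain ⟨f', h1, h2⟩ := hf.exists_hasPartials
  obtain ⟨g', h3, h4⟩ := hg.exists_hasPartials
  refine ⟨hf.continuousOn.prodMk hg.continuousOn, fun i x => (f' i x, g' i x),
    fun i => ⟨_, _, h1 i, h3 i, rfl⟩, fun x hx w => ?_⟩
  simpa [← prod_mk_sum] using (h2 x hx w).prodMk_nhds (h4 x hx w)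

theorem clm_comp {s : Set V} {f : V → W} (L : W →L[ℝ] Z) (hf : FSmoothOn f s) :
    FSmoothOn (fun x => L (f x)) s := by
  refine ⟨{F | ∃ f, FSmoothOn f s ∧ F = fun x => L (f x)}, ⟨f, hf, rfl⟩, ?_⟩
  rintro _ ⟨f, hf, rfl⟩
  obtain ⟨f', h1, h2⟩ := hf.exists_hasPartials
  refine ⟨L.continuous.comp_continuousOn hf.continuousOn, fun i x => L (f' i x),
    fun i => ⟨_, h1 i, rfl⟩, fun x hx w => ?_⟩
  simpa [map_sum, Function.comp_def] using (L.continuous.tendsto _).comp (h2 x hx w)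

end FSmoothOn

/-- The closed class consists of the `C^∞` maps themselves, with `fderivWithin` in basis directions
as partial derivatives; unique differentiability keeps these `C^∞` up to the boundary. -/
theorem ContDiffOn.fSmoothOn {W : Type*} [NormedAddCommGroup W] [NormedSpace ℝ W] {f : V → W}
    {s : Set V} (hs : UniqueDiffOn ℝ s) (hf : ContDiffOn ℝ ∞ f s) : FSmoothOn f s := by
  refine ⟨{f | ContDiffOn ℝ ∞ f s}, hf, fun g hg => ⟨ContDiffOn.continuousOn hg, fun i x =>
    fderivWithin ℝ g s x (Module.finBasis ℝ V i), fun i => ?_, fun x hx w => ?_⟩⟩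
  · exact (ContDiffOn.fderivWithin hg hs (by simp)).clm_apply contDiffOn_const
  · have hd : HasFDerivAt g (fderivWithin ℝ g s x) x := by
      have := ((ContDiffOn.differentiableOn hg (by simp)) x
        (interior_subset hx)).hasFDerivWithinAt
      exact this.hasFDerivAt (mem_interior_iff_mem_nhds.1 hx)
    have e : ∑ i, (Module.finBasis ℝ V).repr w i •
        fderivWithin ℝ g s x (Module.finBasis ℝ V i) = fderivWithin ℝ g s x w := by
      conv_rhs => rw [← (Module.finBasis ℝ V).sum_repr w, map_sum]
      simp only [map_smul]
    rw [e]
    have h1 := (hd.hasLineDerivAt w).tendsto_slope_zero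
    simpa using h1

theorem IsConvexCornered.uniqueDiffOn {s : Set V} (hs : IsConvexCornered s) :
    UniqueDiffOn ℝ s := by
  obtain ⟨O, R, hO, hR, hne, rfl⟩ := hs
  rw [inter_comm]
  exact (uniqueDiffOn_convex hR hne).inter hO

variable [IsTopologicalAddGroup W] [ContinuousSMul ℝ W]

theorem FSmoothOn.smul {s : Set V} {c : V → ℝ} {f : V → W} (hc : FSmoothOn c s)
    (hf : FSmoothOn f s) : FSmoothOn (fun x => c x • f x) s := by
  refine FSmoothOn.of_closure (𝒜 := {F | ∃ (c : V → ℝ) (f : V → W),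
    FSmoothOn c s ∧ FSmoothOn f s ∧ F = fun x => c x • f x}) ?_
    (AddSubmonoid.subset_closure ⟨c, f, hc, hf, rfl⟩)
  rintro _ ⟨c, f, hc, hf, rfl⟩
  obtain ⟨c', h1, h2⟩ := hc.exists_hasPartials
  obtain ⟨f', h3, h4⟩ := hf.exists_hasPartials
  refine ⟨hc.continuousOn.smul hf.continuousOn,
    fun i => (fun x => c' i x • f x) + (fun x => c x • f' i x), fun i =>
      add_mem (AddSubmonoid.subset_closure ⟨_, _, h1 i, hf, rfl⟩)
        (AddSubmonoid.subset_closure ⟨_, _, hc, h3 i, rfl⟩), fun x hx w => ?_⟩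
  have hfx : Tendsto (fun h : ℝ => f (x + h • w)) (𝓝[≠] 0) (𝓝 (f x)) :=
    (hf.continuousOn x (interior_subset hx)).tendsto.comp (tendsto_add_smul_nhdsWithin hx w)
  have e : ∑ i, (Module.finBasis ℝ V).repr w i •
      ((fun x => c' i x • f x) + (fun x => c x • f' i x)) x =
      (∑ i, (Module.finBasis ℝ V).repr w i • c' i x) • f x +
      c x • ∑ i, (Module.finBasis ℝ V).repr w i • f' i x := by
    simp only [Pi.add_apply, smul_add, Finset.sum_add_distrib, Finset.sum_smul, Finset.smul_sum]
    congr 1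
    · simp only [smul_eq_mul, mul_smul]
    · exact Finset.sum_congr rfl fun i _ => smul_comm _ _ _
  rw [e]
  refine (((h2 x hx w).smul hfx).add ((h4 x hx w).const_smul (c x))).congr fun t => ?_
  simp only [smul_eq_mul, smul_sub, mul_smul, sub_smul, mul_sub]
  rw [smul_comm (c x) t⁻¹, smul_comm (c x) t⁻¹]
  abel

/-- Partial derivatives chosen locally are determined on interiors, hence by continuity agree on
overlaps; the diagonal choice `f' y i y` therefore glues them. -/
theorem FSmoothOn.of_locally [T2Space W] {s : Set V} (hs : IsConvexCornered s) {f : V → W}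
    (h : ∀ x ∈ s, ∃ O, IsOpen O ∧ x ∈ O ∧ FSmoothOn f (O ∩ s)) : FSmoothOn f s := by
  refine ⟨{f | ∀ x ∈ s, ∃ O, IsOpen O ∧ x ∈ O ∧ FSmoothOn f (O ∩ s)}, h, fun f h => ?_⟩
  choose! O hO hxO hf using h
  choose! f' h1 h2 using fun x hx => (hf x hx).exists_hasPartials
  have key : ∀ x ∈ s, ∀ i, EqOn (f' x i) (fun y => f' y i y) (O x ∩ s) := by
    rintro x hx i y ⟨hy, hys⟩
    have hc : IsConvexCornered (O x ∩ (O y ∩ s)) := (hs.inter_left (hO y hys)).inter_left (hO x hx)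
    have i1 : O x ∩ (O y ∩ s) ⊆ O x ∩ s := fun z hz => ⟨hz.1, hz.2.2⟩
    have i2 : O x ∩ (O y ∩ s) ⊆ O y ∩ s := fun z hz => hz.2
    exact hc.eqOn_of_interior ((h1 x hx i).continuousOn.mono i1)
      ((h1 y hys i).continuousOn.mono i2)
      (((h2 x hx).mono i1).eqOn ((h2 y hys).mono i2) i) ⟨hy, hxO y hys, hys⟩
  refine ⟨fun x hx => ?_, fun i y => f' y i y, fun i x hx => ⟨O x, hO x hx, hxO x hx,
    (h1 x hx i).congr (key x hx i)⟩, fun x hx w => ?_⟩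
  · have := (hf x hx).continuousOn x ⟨hxO x hx, hx⟩
    rwa [ContinuousWithinAt, inter_comm, nhdsWithin_inter_of_mem'
      (nhdsWithin_le_nhds ((hO x hx).mem_nhds (hxO x hx)))] at this
  · have hxs := interior_subset hx
    exact h2 x hxs x (by rw [interior_inter, (hO x hxs).interior_eq]; exact ⟨hxO x hxs, hx⟩) w

/-- Smooth maps between locally convex spaces preserve smoothness under composition. -/
theorem LCSmoothOn.comp_fSmoothOn [LocallyConvexSpace ℝ W]
    [IsTopologicalAddGroup Z] [ContinuousSMul ℝ Z] [LocallyConvexSpace ℝ Z] [T2Space Z]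
    {g : W → Z} {t : Set W} (ht : IsConvexCornered t) (hg : LCSmoothOn g t)
    {f : V → W} {s : Set V} (hf : FSmoothOn f s) (hst : MapsTo f s t) :
    FSmoothOn (fun x => g (f x)) s := by
  obtain ⟨D, hD0, hD⟩ := lcSmoothOn_iff.1 hg
  -- The maps `x ↦ D k (f x) (a₁ x, …, a_k x)` with smooth `a_l` form a class whose partial
  -- derivatives are sums of members; `g ∘ f` is the case `k = 0`.
  have hmem : (fun x => D 0 (f x) (fun i => i.elim0)) ∈ {F : V → Z | ∃ (k : ℕ)
      (a : Fin k → V → W), (∀ l, FSmoothOn (a l) s) ∧ F = fun x => D k (f x) fun l => a l x} :=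
    ⟨0, fun i => i.elim0, fun l => l.elim0, by ext x; congr; ext i; exact i.elim0⟩
  refine (FSmoothOn.of_closure (s := s) ?_ (AddSubmonoid.subset_closure hmem)).congr
    fun x hx => hD0 _ (hst hx) _
  rintro _ ⟨k, a, ha, rfl⟩
  obtain ⟨f', hf', hff⟩ := hf.exists_hasPartials
  choose a' ha' haa using fun l => (ha l).exists_hasPartials
  -- Chain rule: differentiating the base point appends the slot `∂ᵢf`; differentiating the `l`-th
  -- argument replaces `a_l` by `∂ᵢa_l`.
  refine ⟨?_, fun i => (fun x => D (k + 1) (f x)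
      fun l => (Fin.snoc (α := fun _ => V → W) a (f' i) : Fin (k + 1) → V → W) l x) +
    ∑ l, fun x => D k (f x) fun j => Function.update a l (a' l i) j x, fun i => ?_, ?_⟩
  · exact (hD.continuousOn k).comp (f := fun x => (f x, fun l => a l x))
      (hf.continuousOn.prodMk (continuousOn_pi.2 fun l => (ha l).continuousOn))
      fun x hx => ⟨hst hx, mem_univ _⟩
  · refine add_mem (AddSubmonoid.subset_closure ⟨k + 1, _, fun l => ?_, rfl⟩)
      (sum_mem fun l _ => AddSubmonoid.subset_closure ⟨k, _, fun j => ?_, rfl⟩)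
    · refine Fin.lastCases ?_ (fun j => ?_) l
      · simpa using hf' i
      · simpa using ha j
    · rcases eq_or_ne j l with rfl | h
      · simpa using ha' j i
      · simpa [h] using ha j
  · intro x hx w
    have hxs := interior_subset hx
    have hfx := hst hxs
    set m := hD.multilinear ht hfx with hmdef
    have hm : ∀ k v, D k (f x) v = m k v := fun k v => rfl
    have hlim := tendsto_add_smul_nhdsWithin hx w
    have hs' : ∀ᶠ h : ℝ in 𝓝[≠] 0, x + h • w ∈ s := hlim.eventually_mem self_mem_nhdsWithin
    have hfl : Tendsto (fun h : ℝ => f (x + h • w)) (𝓝[≠] 0) (𝓝[t] (f x)) :=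
      tendsto_nhdsWithin_iff.2 ⟨(hf.continuousOn x hxs).tendsto.comp hlim,
        hs'.mono fun h hh => hst hh⟩
    have hal : Tendsto (fun h : ℝ => fun l => a l (x + h • w)) (𝓝[≠] 0) (𝓝 fun l => a l x) :=
      tendsto_pi_nhds.2 fun l => ((ha l).continuousOn x hxs).tendsto.comp hlim
    have hcancel : ∀ h : ℝ, h ≠ 0 →
        f x + h • (h⁻¹ • (f (x + h • w) - f x)) = f (x + h • w) := fun h hh => by
      rw [smul_smul, mul_inv_cancel₀ hh, one_smul, add_sub_cancel]
    -- The increment is split in two: `t1` moves the base point with the arguments already at `x + h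
    -- • w`, and `t2` moves the arguments at the fixed base point `f x`.
    have t1 := hD.tendsto_slope ht hfx (l := 𝓝[≠] (0 : ℝ)) (h := id) (y := fun _ => f x)
      (δ := fun h => h⁻¹ • (f (x + h • w) - f x)) self_mem_nhdsWithin
      (tendsto_nhdsWithin_iff.2 ⟨tendsto_const_nhds, Eventually.of_forall fun _ => hfx⟩)
      (hfl.congr' (by
        filter_upwards [self_mem_nhdsWithin] with h hh
        exact (hcancel h hh).symm)) (hff x hx w) hal
    have t2 := MultilinearMap.tendsto_slope (m k) (hD.continuous_right hfx) (h := id) hal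
      (w := fun l => ∑ i, (Module.finBasis ℝ V).repr w i • a' l i x)
      (tendsto_pi_nhds.2 fun l => haa l x hx w)
    have e : ∑ i, (Module.finBasis ℝ V).repr w i • ((fun x => D (k + 1) (f x)
        fun l => (Fin.snoc (α := fun _ => V → W) a (f' i) : Fin (k + 1) → V → W) l x) +
        ∑ l, fun x => D k (f x) fun j => Function.update a l (a' l i) j x) x =
        D (k + 1) (f x) (Fin.snoc (α := fun _ => W) (fun l => a l x)
          (∑ i, (Module.finBasis ℝ V).repr w i • f' i x)) +
        ∑ l, m k (Function.update (fun l => a l x) l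
          (∑ i, (Module.finBasis ℝ V).repr w i • a' l i x)) := by
      have e1 : ∀ i, (fun l => (Fin.snoc (α := fun _ => V → W) a (f' i) : Fin (k + 1) → V → W) l x)
          = Function.update (Fin.snoc (α := fun _ => W) (fun l => a l x) 0) (Fin.last k)
            (f' i x) := by
        intro i
        ext l
        refine Fin.lastCases ?_ (fun j => ?_) l <;> simp
      have e2 : ∀ l i, (fun j => Function.update a l (a' l i) j x) =
          Function.update (fun l => a l x) l (a' l i x) := by
        intro l i
        ext j
        rcases eq_or_ne j l with rfl | h
        · simp
        · simp [h]
      have e3 : ∀ u, (Fin.snoc (α := fun _ => W) (fun l => a l x) u : Fin (k + 1) → W) =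
          Function.update (Fin.snoc (α := fun _ => W) (fun l => a l x) 0) (Fin.last k) u :=
        fun u => (Fin.update_snoc_last _ _ _).symm
      rw [e3]
      simp only [Pi.add_apply, Finset.sum_apply, smul_add, Finset.sum_add_distrib, hm, e1, e2,
        MultilinearMap.map_update_sum, MultilinearMap.map_update_smul, Finset.smul_sum]
      rw [Finset.sum_comm (γ := Fin k)]
    rw [e]
    refine (t1.add t2).congr' ?_
    filter_upwards [self_mem_nhdsWithin] with h hh
    simp only [id, hcancel h hh, ← hm, ← smul_add]
    congr 1
    abel

/-- Iterated differentials of a map belonging to a class closed under partial derivatives. -/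
def iteratedPartials (d : (V → W) → Fin (Module.finrank ℝ V) → V → W) :
    (k : ℕ) → (V → W) → V → (Fin k → V) → W
  | 0, g, x, _ => g x
  | k + 1, g, x, v => ∑ i, (Module.finBasis ℝ V).repr (v 0) i •
      iteratedPartials d k (d g i) x (Fin.tail v)

/-- `iteratedPartials` consumes the first vector while the new direction is appended last, so the
induction on `k` runs over all members of the class and applies to the partial derivatives of `f`.
-/
theorem FSmoothOn.lcSmoothOn {f : V → W} {s : Set V} (hf : FSmoothOn f s) : LCSmoothOn f s := by
  obtain ⟨𝒜, hf, h⟩ := hf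
  choose! hc d hd hp using h
  refine ⟨fun k => iteratedPartials d k f, fun _ _ _ => rfl, fun k => ?_, fun k => ?_⟩
  · clear hp
    induction k generalizing f with
    | zero => exact (hc f hf).comp continuousOn_fst fun p hp => hp.1
    | succ k ih =>
      simp only [iteratedPartials]
      refine continuousOn_finsetSum _ fun i _ => ContinuousOn.smul ?_ ?_
      · have h1 : Continuous fun w : V => (Module.finBasis ℝ V).repr w i :=
          ((Module.finBasis ℝ V).coord i).continuous_of_finiteDimensional
        exact (h1.comp (by fun_prop : Continuous fun p : V × (Fin (k + 1) → V) => p.2 0)).continuousOn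
      · refine (ih (hd f hf i)).comp (f := fun p : V × (Fin (k + 1) → V) => (p.1, Fin.tail p.2))
          (Continuous.continuousOn ?_) fun p hp => ⟨hp.1, mem_univ _⟩
        refine continuous_fst.prodMk (continuous_pi fun j => ?_)
        exact (continuous_apply j.succ).comp continuous_snd
  · intro x hx v w
    induction k generalizing f with
    | zero =>
      simpa [iteratedPartials, Fin.snoc] using hp f hf x hx w
    | succ k ih =>
      have h1 := tendsto_finsetSum Finset.univ fun i _ =>
        (ih (hd f hf i) (Fin.tail v)).const_smul ((Module.finBasis ℝ V).repr (v 0) i)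
      have e1 : (Fin.snoc (α := fun _ => V) v w : Fin (k + 2) → V) 0 = v 0 :=
        Fin.snoc_castSucc (α := fun _ => V) w v 0
      have e2 : Fin.tail (Fin.snoc (α := fun _ => V) v w : Fin (k + 2) → V) =
          Fin.snoc (α := fun _ => V) (Fin.tail v) w := by
        ext j
        refine Fin.lastCases ?_ (fun j => ?_) j
        · simp [Fin.tail, Fin.succ_last]
        · simp [Fin.tail, -Fin.castSucc_succ, Fin.succ_castSucc]
      have e3 : iteratedPartials d (k + 2) f x (Fin.snoc (α := fun _ => V) v w) =
          ∑ i, (Module.finBasis ℝ V).repr (v 0) i • iteratedPartials d (k + 1) (d f i) x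
            (Fin.snoc (α := fun _ => V) (Fin.tail v) w) := by
        rw [iteratedPartials.eq_2, e1, e2]
      simp only [e3]
      refine h1.congr fun t => ?_
      simp only [iteratedPartials]
      rw [← Finset.sum_sub_distrib, Finset.smul_sum]
      refine Finset.sum_congr rfl fun i _ => ?_
      rw [smul_comm, smul_sub, smul_sub]

end FiniteDimensional

/-! ### Smoothness near a point of a cornered set -/

section Near

variable {V V' W Z : Type*} [NormedAddCommGroup V] [NormedSpace ℝ V] [FiniteDimensional ℝ V]
  [AddCommGroup W] [Module ℝ W] [TopologicalSpace W]
  [AddCommGroup Z] [Module ℝ Z] [TopologicalSpace Z]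

/-- `f` is smooth on a relative neighbourhood of `v` in `R`. -/
def FSmoothNear (f : V → W) (R : Set V) (v : V) : Prop :=
  ∃ O, IsOpen O ∧ v ∈ O ∧ FSmoothOn f (O ∩ R)

namespace FSmoothNear

variable {R : Set V} {v : V}

theorem continuousWithinAt {f : V → W} (hf : FSmoothNear f R v) (hv : v ∈ R) :
    ContinuousWithinAt f R v := by
  obtain ⟨O, hO, hvO, hf⟩ := hf
  have := hf.continuousOn v ⟨hvO, hv⟩
  rwa [ContinuousWithinAt, inter_comm, nhdsWithin_inter_of_mem'
      (nhdsWithin_le_nhds (hO.mem_nhds hvO))] at this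

/-- Passage to a smaller neighbourhood on which a given property holds. -/
theorem exists_subset {f : V → W} (hf : FSmoothNear f R v) {p : V → Prop}
    (hp : ∀ᶠ z in 𝓝[R] v, p z) :
    ∃ O, IsOpen O ∧ v ∈ O ∧ FSmoothOn f (O ∩ R) ∧ ∀ z ∈ O ∩ R, p z := by
  obtain ⟨O, hO, hvO, hf⟩ := hf
  obtain ⟨O', hO', hv', hp⟩ := mem_nhdsWithin.1 hp
  exact ⟨O ∩ O', hO.inter hO', ⟨hvO, hv'⟩, hf.mono fun z hz => ⟨hz.1.1, hz.2⟩,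
    fun z hz => hp ⟨hz.1.2, hz.2⟩⟩

theorem congr {f g : V → W} (hf : FSmoothNear f R v) (h : f =ᶠ[𝓝[R] v] g) :
    FSmoothNear g R v := by
  obtain ⟨O, h1, h2, h3, h4⟩ := hf.exists_subset h
  exact ⟨O, h1, h2, h3.congr h4⟩

theorem of_pair {Y : Type*} [AddCommGroup Y] [Module ℝ Y] [TopologicalSpace Y]
    {f : V → W} {g : V → Z} {F : V → Y} (hf : FSmoothNear f R v)
    (hg : FSmoothNear g R v) (h : ∀ s, FSmoothOn f s → FSmoothOn g s → FSmoothOn F s) :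
    FSmoothNear F R v := by
  obtain ⟨O, h1, h2, h3⟩ := hf
  obtain ⟨O', h1', h2', h3'⟩ := hg
  exact ⟨O ∩ O', h1.inter h1', ⟨h2, h2'⟩, h _ (h3.mono fun z hz => ⟨hz.1.1, hz.2⟩)
    (h3'.mono fun z hz => ⟨hz.1.2, hz.2⟩)⟩

theorem comp [IsTopologicalAddGroup W] [ContinuousSMul ℝ W] [LocallyConvexSpace ℝ W]
    [IsTopologicalAddGroup Z] [ContinuousSMul ℝ Z] [LocallyConvexSpace ℝ Z] [T2Space Z]
    {f : V → W} {g : W → Z} {t : Set W} (hg : LCSmoothOn g t) (ht : IsConvexCornered t)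
    (hf : FSmoothNear f R v) (h : ∀ᶠ z in 𝓝[R] v, f z ∈ t) :
    FSmoothNear (fun z => g (f z)) R v := by
  obtain ⟨O, h1, h2, h3, h4⟩ := hf.exists_subset h
  exact ⟨O, h1, h2, hg.comp_fSmoothOn ht h3 h4⟩

end FSmoothNear

end Near

/-! ### Images of charts in the model space -/

section Models

variable {V H : Type*} [AddCommGroup V] [Module ℝ V] [TopologicalSpace V] [TopologicalSpace H]
  {P : Type*} [TopologicalSpace P]

theorem LCModel.image_eq (I : LCModel V H) (A : Set H) :
    I.toFun '' A = I.invFun ⁻¹' A ∩ range I.toFun := by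
  ext v
  constructor
  · rintro ⟨h, hh, rfl⟩
    exact ⟨by simpa [I.left_inv] using hh, h, rfl⟩
  · rintro ⟨h1, h, rfl⟩
    exact ⟨h, by simpa [I.left_inv] using h1, rfl⟩

theorem LCModel.isConvexCornered_image (I : LCModel V H) {A : Set H} (hA : IsOpen A) :
    IsConvexCornered (I.toFun '' A) :=
  ⟨_, _, hA.preimage I.continuous_invFun, I.convex_range, I.nonempty_interior, I.image_eq A⟩

theorem LCModel.isConvexCornered_chart (I : LCModel V H) (φ : OpenPartialHomeomorph P H)
    {U : Set P} (hU : IsOpen U) : IsConvexCornered (I.toFun '' (φ.target ∩ φ.symm ⁻¹' U)) :=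
  I.isConvexCornered_image (φ.isOpen_inter_preimage_symm hU)

end Models

/-! ### Pointwise smoothness of maps between manifolds -/

section SmoothAt

variable {V H W K P Q : Type*} [NormedAddCommGroup V] [NormedSpace ℝ V]
  [FiniteDimensional ℝ V] [TopologicalSpace H]
  [AddCommGroup W] [Module ℝ W] [TopologicalSpace W] [TopologicalSpace K]
  [TopologicalSpace P] [ChartedSpace H P] [TopologicalSpace Q] [ChartedSpace K Q]

/-- `F` is smooth in a neighbourhood of `x`, in suitable charts. -/
def LCSmoothAt (I : ModelWithCorners ℝ V H) (J : LCModel W K) (F : P → Q) (x : P) : Prop :=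
  ContinuousAt F x ∧ ∃ φ ∈ atlas H P, x ∈ φ.source ∧ ∃ ψ ∈ atlas K Q, F x ∈ ψ.source ∧
    FSmoothNear (fun v => J.toFun (ψ (F (φ.symm (I.symm v))))) (range I) (I (φ x))

theorem OpenPartialHomeomorph.tendsto_symm_model (I : ModelWithCorners ℝ V H)
    {φ : OpenPartialHomeomorph P H} {x : P} (hx : x ∈ φ.source) :
    Tendsto (fun v => φ.symm (I.symm v)) (𝓝[range I] (I (φ x))) (𝓝 x) := by
  have h1 : Tendsto I.symm (𝓝[range I] (I (φ x))) (𝓝 (φ x)) := by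
    have := I.continuous_symm.tendsto (I (φ x))
    rw [I.left_inv] at this
    exact this.mono_left nhdsWithin_le_nhds
  exact (φ.tendsto_symm hx).comp h1

namespace LCSmoothAt

variable {I : ModelWithCorners ℝ V H} {J : LCModel W K} {F G : P → Q} {x : P}

theorem congr (hF : LCSmoothAt I J F x) (h : F =ᶠ[𝓝 x] G) : LCSmoothAt I J G x := by
  obtain ⟨hc, φ, hφ, hx, ψ, hψ, hFx, hn⟩ := hF
  refine ⟨hc.congr h, φ, hφ, hx, ψ, hψ, h.self_of_nhds ▸ hFx, hn.congr ?_⟩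
  filter_upwards [(φ.tendsto_symm_model I hx).eventually h] with v hv
  rw [hv]

section
variable [IsTopologicalAddGroup W] [ContinuousSMul ℝ W] [LocallyConvexSpace ℝ W] [T2Space W]

/-- Change of the chart of the target. -/
theorem change_target (hQ : IsLCManifold J Q) (hF : ContinuousAt F x)
    {φ : OpenPartialHomeomorph P H} (hx : x ∈ φ.source) {ψ ψ' : OpenPartialHomeomorph Q K}
    (hψ : ψ ∈ atlas K Q) (hψ' : ψ' ∈ atlas K Q) (hFx : F x ∈ ψ.source) (hFx' : F x ∈ ψ'.source)
    (hn : FSmoothNear (fun v => J.toFun (ψ (F (φ.symm (I.symm v))))) (range I) (I (φ x))) :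
    FSmoothNear (fun v => J.toFun (ψ' (F (φ.symm (I.symm v))))) (range I) (I (φ x)) := by
  have hev : ∀ᶠ v in 𝓝[range I] (I (φ x)), F (φ.symm (I.symm v)) ∈ ψ.source ∩ ψ'.source :=
    (hF.tendsto.comp (φ.tendsto_symm_model I hx)).eventually_mem
      ((ψ.open_source.inter ψ'.open_source).mem_nhds ⟨hFx, hFx'⟩)
  refine (hn.comp (hQ ψ hψ ψ' hψ') (J.isConvexCornered_chart ψ ψ'.open_source) ?_).congr ?_
  · filter_upwards [hev] with v hv
    refine ⟨_, ⟨ψ.map_source hv.1, ?_⟩, rfl⟩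
    rw [mem_preimage, ψ.left_inv hv.1]
    exact hv.2
  · filter_upwards [hev] with v hv
    rw [J.left_inv, ψ.left_inv hv.1]

/-- Composition with a smooth map of finite-dimensional manifolds, in any chart of the source. -/
theorem repr_comp_contMDiff {V' H' P' : Type*} [NormedAddCommGroup V'] [NormedSpace ℝ V']
    [FiniteDimensional ℝ V'] [TopologicalSpace H'] {I' : ModelWithCorners ℝ V' H'}
    [TopologicalSpace P'] [ChartedSpace H' P'] [IsManifold I ∞ P] [IsManifold I' ∞ P']
    {f : P' → P} (hf : ContMDiff I' I ∞ f) {x : P'}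
    {φ : OpenPartialHomeomorph P H} (hφ : φ ∈ atlas H P) (hx : f x ∈ φ.source)
    {φ' : OpenPartialHomeomorph P' H'} (hφ' : φ' ∈ atlas H' P') (hx' : x ∈ φ'.source)
    {g : P → W} (hn : FSmoothNear (fun v => g (φ.symm (I.symm v))) (range I) (I (φ (f x)))) :
    FSmoothNear (fun v => g (f (φ'.symm (I'.symm v)))) (range I') (I' (φ' x)) := by
  obtain ⟨O, hO, hxO, hs⟩ := hn
  have hU : IsOpen (φ'.source ∩ f ⁻¹' φ.source) :=
    φ'.open_source.inter (φ.open_source.preimage hf.continuous)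
  have h1 := ((contMDiffOn_iff_of_mem_maximalAtlas (IsManifold.subset_maximalAtlas hφ')
    (IsManifold.subset_maximalAtlas hφ) inter_subset_left
    (show MapsTo f (φ'.source ∩ f ⁻¹' φ.source) φ.source from fun y hy => hy.2)).1
    (hf.contMDiffOn (s := φ'.source ∩ f ⁻¹' φ.source))).2
  have hset : φ'.extend I' '' (φ'.source ∩ f ⁻¹' φ.source) =
      (I'.symm ⁻¹' (φ'.target ∩ φ'.symm ⁻¹' (f ⁻¹' φ.source))) ∩ range I' := by
    rw [OpenPartialHomeomorph.extend_coe, image_comp, φ'.image_source_inter_eq']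
    exact (LCModel.ofModelWithCorners I').image_eq _
  rw [hset] at h1
  have hO' : IsOpen (I'.symm ⁻¹' (φ'.target ∩ φ'.symm ⁻¹' (f ⁻¹' φ.source))) :=
    (φ'.isOpen_inter_preimage_symm (φ.open_source.preimage hf.continuous)).preimage
      I'.continuous_symm
  have hcc : IsConvexCornered
      ((I'.symm ⁻¹' (φ'.target ∩ φ'.symm ⁻¹' (f ⁻¹' φ.source))) ∩ range I') :=
    ⟨_, _, hO', I'.convex_range, I'.nonempty_interior, rfl⟩
  have hxm : I' (φ' x) ∈ I'.symm ⁻¹' (φ'.target ∩ φ'.symm ⁻¹' (f ⁻¹' φ.source)) := by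
    simp [φ'.map_source hx', φ'.left_inv hx', hx]
  have h2 : FSmoothNear (fun v => I (φ (f (φ'.symm (I'.symm v))))) (range I') (I' (φ' x)) :=
    ⟨_, hO', hxm, h1.fSmoothOn hcc.uniqueDiffOn⟩
  have hcO : IsConvexCornered (O ∩ range I) :=
    ⟨_, _, hO, I.convex_range, I.nonempty_interior, rfl⟩
  have h3 := h2.continuousWithinAt (mem_range_self _)
  -- `g` in the chart `φ` is put into `LCSmoothOn` form, so the same chain rule also covers
  -- composition with a transition between finite-dimensional charts.
  refine (h2.comp hs.lcSmoothOn hcO ?_).congr ?_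
  · have : I (φ (f (φ'.symm (I'.symm (I' (φ' x)))))) ∈ O := by
      simpa [φ'.left_inv hx'] using hxO
    filter_upwards [h3.tendsto.eventually_mem (hO.mem_nhds this)] with v hv
    exact ⟨hv, mem_range_self _⟩
  · filter_upwards [(φ'.tendsto_symm_model I' hx').eventually_mem
      ((φ.open_source.preimage hf.continuous).mem_nhds hx)] with v hv
    simp only [I.left_inv]
    rw [φ.left_inv hv]

theorem comp_contMDiff {V' H' P' : Type*} [NormedAddCommGroup V'] [NormedSpace ℝ V']
    [FiniteDimensional ℝ V'] [TopologicalSpace H'] {I' : ModelWithCorners ℝ V' H'}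
    [TopologicalSpace P'] [ChartedSpace H' P'] [IsManifold I ∞ P] [IsManifold I' ∞ P']
    {f : P' → P} (hf : ContMDiff I' I ∞ f) {x : P'} (hF : LCSmoothAt I J F (f x)) :
    LCSmoothAt I' J (fun y => F (f y)) x := by
  obtain ⟨hc, φ, hφ, hx, ψ, hψ, hFx, hn⟩ := hF
  exact ⟨hc.comp hf.continuous.continuousAt, chartAt H' x, chart_mem_atlas _ _,
    mem_chart_source _ _, ψ, hψ, hFx,
    repr_comp_contMDiff hf hφ hx (chart_mem_atlas H' x) (mem_chart_source H' x)
      (g := fun y => J.toFun (ψ (F y))) hn⟩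

/-- The charts in the definition can be chosen arbitrarily. -/
theorem repr [IsManifold I ∞ P] (hQ : IsLCManifold J Q) (hF : LCSmoothAt I J F x)
    {φ : OpenPartialHomeomorph P H} (hφ : φ ∈ atlas H P) (hx : x ∈ φ.source)
    {ψ : OpenPartialHomeomorph Q K} (hψ : ψ ∈ atlas K Q) (hFx : F x ∈ ψ.source) :
    FSmoothNear (fun v => J.toFun (ψ (F (φ.symm (I.symm v))))) (range I) (I (φ x)) := by
  obtain ⟨hc, φ', hφ', hx', ψ', hψ', hFx', hn⟩ := hF
  exact change_target hQ hc hx hψ' hψ hFx' hFx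
    (repr_comp_contMDiff contMDiff_id hφ' hx' hφ hx (g := fun y => J.toFun (ψ' (F y))) hn)

/-- The way back to the definition of smoothness in the theorem: `repr` passes to arbitrary charts,
and `FSmoothOn.of_locally` glues. -/
theorem lcSmoothMapOn [IsManifold I ∞ P] (hQ : IsLCManifold J Q) {U : Set P} (hU : IsOpen U)
    (h : ∀ x ∈ U, LCSmoothAt I J F x) : LCSmoothMapOn (LCModel.ofModelWithCorners I) J F U := by
  have hc : ContinuousOn F U := fun x hx => (h x hx).1.continuousWithinAt
  refine ⟨hc, fun φ hφ ψ hψ => FSmoothOn.lcSmoothOn (FSmoothOn.of_locally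
    (LCModel.isConvexCornered_chart _ φ (hc.isOpen_inter_preimage hU ψ.open_source)) ?_)⟩
  rintro _ ⟨v, ⟨hv, hvU, hvψ⟩, rfl⟩
  have h1 := (h _ hvU).repr hQ hφ (φ.map_target hv) hψ hvψ
  rw [φ.right_inv hv] at h1
  obtain ⟨O, hO, hvO, hs⟩ := h1
  refine ⟨O, hO, hvO, hs.mono ?_⟩
  rintro _ ⟨h1, ⟨v', -, rfl⟩⟩
  exact ⟨h1, mem_range_self _⟩

theorem comp {W' K' Q' : Type*} [AddCommGroup W'] [Module ℝ W'] [TopologicalSpace W']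
    [IsTopologicalAddGroup W'] [ContinuousSMul ℝ W'] [LocallyConvexSpace ℝ W'] [T2Space W']
    [TopologicalSpace K'] [TopologicalSpace Q'] [ChartedSpace K' Q'] {J' : LCModel W' K'}
    {G : Q → Q'} {U : Set Q} (hG : LCSmoothMapOn J J' G U) (hU : IsOpen U)
    (hF : LCSmoothAt I J F x) (hx : F x ∈ U) : LCSmoothAt I J' (fun y => G (F y)) x := by
  obtain ⟨hc, φ, hφ, hxφ, ψ, hψ, hFx, hn⟩ := hF
  refine ⟨(hG.1.continuousAt (hU.mem_nhds hx)).comp hc, φ, hφ, hxφ, chartAt K' (G (F x)),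
    chart_mem_atlas _ _, mem_chart_source _ _, ?_⟩
  have hopen : IsOpen (U ∩ G ⁻¹' (chartAt K' (G (F x))).source) :=
    hG.1.isOpen_inter_preimage hU (chartAt K' (G (F x))).open_source
  have hev : ∀ᶠ v in 𝓝[range I] (I (φ x)), F (φ.symm (I.symm v)) ∈
      ψ.source ∩ (U ∩ G ⁻¹' (chartAt K' (G (F x))).source) :=
    (hc.tendsto.comp (φ.tendsto_symm_model I hxφ)).eventually_mem
      ((ψ.open_source.inter hopen).mem_nhds ⟨hFx, hx, mem_chart_source _ _⟩)
  refine (hn.comp (hG.2 ψ hψ _ (chart_mem_atlas _ _)) (J.isConvexCornered_chart ψ hopen)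
    ?_).congr ?_
  · filter_upwards [hev] with v hv
    refine ⟨_, ⟨ψ.map_source hv.1, ?_⟩, rfl⟩
    rw [mem_preimage, ψ.left_inv hv.1]
    exact hv.2
  · filter_upwards [hev] with v hv
    rw [J.left_inv, ψ.left_inv hv.1]

end

variable (I) in
theorem id (x : P) : LCSmoothAt I (LCModel.ofModelWithCorners I) (fun y : P => y) x := by
  refine ⟨continuousAt_id, chartAt H x, chart_mem_atlas _ _, mem_chart_source _ _, chartAt H x,
    chart_mem_atlas _ _, mem_chart_source _ _, ?_⟩
  have hcc : IsConvexCornered (I.symm ⁻¹' (chartAt H x).target ∩ range I) :=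
    ⟨_, _, (chartAt H x).open_target.preimage I.continuous_symm, I.convex_range,
      I.nonempty_interior, rfl⟩
  refine ⟨_, (chartAt H x).open_target.preimage I.continuous_symm, by simp,
    (contDiffOn_id.fSmoothOn hcc.uniqueDiffOn).congr ?_⟩
  rintro _ ⟨h1, v, rfl⟩
  rw [mem_preimage, I.left_inv] at h1
  change I v = I _
  rw [I.left_inv, (chartAt H x).right_inv h1]

theorem _root_.ContMDiff.lcSmoothAt {V' H' P' : Type*} [NormedAddCommGroup V'] [NormedSpace ℝ V']
    [FiniteDimensional ℝ V'] [TopologicalSpace H'] {I' : ModelWithCorners ℝ V' H'}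
    [TopologicalSpace P'] [ChartedSpace H' P'] [IsManifold I ∞ P] [IsManifold I' ∞ P']
    {f : P' → P} (hf : ContMDiff I' I ∞ f) (x : P') :
    LCSmoothAt I' (LCModel.ofModelWithCorners I) f x :=
  (LCSmoothAt.id I (f x)).comp_contMDiff hf

theorem prodMk {W' K' Q' : Type*} [AddCommGroup W'] [Module ℝ W'] [TopologicalSpace W']
    [TopologicalSpace K'] [TopologicalSpace Q'] [ChartedSpace K' Q'] {J' : LCModel W' K'}
    [IsTopologicalAddGroup W'] [ContinuousSMul ℝ W'] [LocallyConvexSpace ℝ W'] [T2Space W']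
    [IsManifold I ∞ P]
    {G : P → Q'} (hF : LCSmoothAt I J F x) (hG : LCSmoothAt I J' G x) :
    LCSmoothAt I (J.prod J') (fun y => (F y, G y)) x := by
  obtain ⟨hc, φ, hφ, hx, ψ, hψ, hFx, hn⟩ := hF
  obtain ⟨hc', φ', hφ', hx', ψ', hψ', hGx, hn'⟩ := hG
  have hn' := repr_comp_contMDiff contMDiff_id hφ' hx' hφ hx (g := fun y => J'.toFun (ψ' (G y))) hn'
  exact ⟨hc.prodMk hc', φ, hφ, hx, ψ.prod ψ', mem_image2_of_mem hψ hψ', ⟨hFx, hGx⟩,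
    hn.of_pair hn' fun s h1 h2 => h1.prodMk h2⟩

theorem snd {W' K' Q' : Type*} [AddCommGroup W'] [Module ℝ W'] [TopologicalSpace W']
    [TopologicalSpace K'] [TopologicalSpace Q'] [ChartedSpace K' Q'] {J' : LCModel W' K'}
    {F : P → Q × Q'} (hF : LCSmoothAt I (J.prod J') F x) :
    LCSmoothAt I J' (fun y => (F y).2) x := by
  obtain ⟨hc, φ, hφ, hx, _, ⟨ψ, hψ, ψ', hψ', rfl⟩, hFx, O, hO, hxO, hn⟩ := hF
  exact ⟨hc.snd, φ, hφ, hx, ψ', hψ', hFx.2, O, hO, hxO,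
    hn.clm_comp (ContinuousLinearMap.snd ℝ W W')⟩

end LCSmoothAt

section VectorValued

variable {I : ModelWithCorners ℝ V H} {X : Type*} [AddCommGroup X] [Module ℝ X]
  [TopologicalSpace X] {f g : P → X} {x : P}

/-- A vector space has only the identity chart in its atlas, so target charts disappear and the
source chart can be fixed. -/
theorem lcSmoothAt_self_iff [IsManifold I ∞ P]
    [IsTopologicalAddGroup X] [ContinuousSMul ℝ X] [LocallyConvexSpace ℝ X] [T2Space X] :
    LCSmoothAt I (LCModel.self X) f x ↔ ContinuousAt f x ∧
      FSmoothNear (fun v => f ((chartAt H x).symm (I.symm v))) (range I) (I (chartAt H x x)) := by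
  constructor
  · rintro ⟨hc, φ, hφ, hx, ψ, hψ, -, hn⟩
    rw [chartedSpaceSelf_atlas] at hψ
    subst hψ
    exact ⟨hc, LCSmoothAt.repr_comp_contMDiff contMDiff_id hφ hx (chart_mem_atlas H x)
      (mem_chart_source H x) (g := f) hn⟩
  · rintro ⟨hc, hn⟩
    exact ⟨hc, _, chart_mem_atlas H x, mem_chart_source H x, OpenPartialHomeomorph.refl X,
      chartedSpaceSelf_atlas.2 rfl, mem_univ _, hn⟩

variable [IsManifold I ∞ P]
    [IsTopologicalAddGroup X] [ContinuousSMul ℝ X] [LocallyConvexSpace ℝ X] [T2Space X]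

theorem LCSmoothAt.const (c : X) (x : P) : LCSmoothAt I (LCModel.self X) (fun _ => c) x :=
  lcSmoothAt_self_iff.2 ⟨continuousAt_const, univ, isOpen_univ, mem_univ _, FSmoothOn.const c _⟩

theorem LCSmoothAt.add (hf : LCSmoothAt I (LCModel.self X) f x)
    (hg : LCSmoothAt I (LCModel.self X) g x) :
    LCSmoothAt I (LCModel.self X) (fun y => f y + g y) x := by
  rw [lcSmoothAt_self_iff] at *
  exact ⟨hf.1.add hg.1, hf.2.of_pair hg.2 fun s h1 h2 => h1.add h2⟩

theorem LCSmoothAt.smul {c : P → ℝ} (hc : ContMDiff I 𝓘(ℝ, ℝ) ∞ c)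
    (hf : LCSmoothAt I (LCModel.self X) f x) :
    LCSmoothAt I (LCModel.self X) (fun y => c y • f y) x := by
  have hc' : LCSmoothAt I (LCModel.self ℝ) c x := hc.lcSmoothAt x
  rw [lcSmoothAt_self_iff] at *
  exact ⟨hc'.1.smul hf.1, hc'.2.of_pair hf.2 fun s h1 h2 => h1.smul h2⟩

theorem LCSmoothAt.sum {ι : Type*} (s : Finset ι) {f : ι → P → X}
    (hf : ∀ i ∈ s, LCSmoothAt I (LCModel.self X) (f i) x) :
    LCSmoothAt I (LCModel.self X) (fun y => ∑ i ∈ s, f i y) x := by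
  classical
  induction s using Finset.induction_on with
  | empty => simpa using LCSmoothAt.const 0 x
  | insert i s hi ih =>
    simp only [Finset.sum_insert hi]
    exact (hf i (by simp)).add (ih fun j hj => hf j (by simp [hj]))

end VectorValued

end SmoothAt

/-! ### Charts of the fibres -/

section FibreChart

variable {V H W K B E M : Type*} [NormedAddCommGroup V] [NormedSpace ℝ V]
  [FiniteDimensional ℝ V] [TopologicalSpace H]
  [AddCommGroup W] [Module ℝ W] [TopologicalSpace W] [TopologicalSpace K]
  [TopologicalSpace B] [ChartedSpace H B] [TopologicalSpace E] [ChartedSpace K E]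

/-- A chart of the fibres of `π : E → M`, with values in the open subset `target` of `X`, and its
inverse, which is parametrized over the subset `dom` of `B` by means of a map `p : B → M`. -/
structure FibreChart (I : ModelWithCorners ℝ V H) (J : LCModel W K) (X : Type*) [AddCommGroup X]
    [Module ℝ X] [TopologicalSpace X] (π : E → M) (p : B → M) where
  source : Set E
  target : Set X
  dom : Set B
  toFun : E → X
  inv : B → X → E
  isOpen_source : IsOpen source
  isOpen_target : IsOpen target
  isOpen_dom : IsOpen dom
  mem_target : ∀ e ∈ source, toFun e ∈ target
  mem_dom : ∀ x, ∀ e ∈ source, π e = p x → x ∈ dom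
  inv_toFun : ∀ x, ∀ e ∈ source, π e = p x → inv x (toFun e) = e
  proj_inv : ∀ x ∈ dom, ∀ y ∈ target, π (inv x y) = p x
  continuousOn_toFun : ContinuousOn toFun source
  continuousOn_inv : ContinuousOn (fun q : B × X => inv q.1 q.2) (dom ×ˢ target)
  smoothAt_toFun : ∀ (F : B → E) (x : B), LCSmoothAt I J F x → F x ∈ source →
    LCSmoothAt I (LCModel.self X) (fun y => toFun (F y)) x
  smoothAt_inv : ∀ (h : B → X) (x : B), LCSmoothAt I (LCModel.self X) h x → x ∈ dom →
    h x ∈ target → LCSmoothAt I J (fun y => inv y (h y)) x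

variable {N X : Type*} {d : ℕ} [TopologicalSpace M]
    [ChartedSpace (EuclideanQuadrant d) M]
    [IsManifold (modelWithCornersEuclideanQuadrant d) ∞ M]
    [AddCommGroup X] [Module ℝ X] [TopologicalSpace X] [IsTopologicalAddGroup X]
    [ContinuousSMul ℝ X] [LocallyConvexSpace ℝ X] [T2Space X]
    [TopologicalSpace N] [ChartedSpace X N]
    {E : Type*} [TopologicalSpace E] [ChartedSpace (ModelProd (EuclideanQuadrant d) X) E]

/-- A trivialization near `π e₀` is followed by a chart of `N` at the fibre coordinate of `e₀`. The
inverse reinserts `p x` as base coordinate, whence its dependence on `x`. -/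
theorem IsSmoothBundle.exists_fibreChart (hN : IsLCManifold (LCModel.self X) N)
    {π : E → M} (hπ : IsSmoothBundle d X N π) (I : ModelWithCorners ℝ V H) [IsManifold I ∞ B]
    {p : B → M} (hp : ContMDiff I (modelWithCornersEuclideanQuadrant d) ∞ p) (e₀ : E) :
    ∃ c : FibreChart I (totalModel d X) X π p, e₀ ∈ c.source := by
  obtain ⟨e, he, hs, hs'⟩ := hπ (π e₀)
  have he₀ : e₀ ∈ e.source := e.mem_source.2 he
  set ψ : OpenPartialHomeomorph N X := chartAt X (e e₀).2 with hψ
  have hψa : ψ ∈ atlas X N := chart_mem_atlas _ _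
  have hopen : IsOpen (e.source ∩ e ⁻¹' (univ ×ˢ ψ.source)) :=
    e.continuousOn_toFun.isOpen_inter_preimage e.open_source (isOpen_univ.prod ψ.open_source)
  have htgt : ∀ x, p x ∈ e.baseSet → ∀ n : N, (p x, n) ∈ e.target := fun x hx n => by
    rw [e.target_eq]
    exact ⟨hx, mem_univ _⟩
  refine ⟨{
    source := e.source ∩ e ⁻¹' (univ ×ˢ ψ.source)
    target := ψ.target
    dom := p ⁻¹' e.baseSet
    toFun := fun z => ψ (e z).2
    inv := fun x y => e.toOpenPartialHomeomorph.symm (p x, ψ.symm y)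
    isOpen_source := hopen
    isOpen_target := ψ.open_target
    isOpen_dom := e.open_baseSet.preimage hp.continuous
    mem_target := fun z hz => ψ.map_source hz.2.2
    mem_dom := fun x z hz h => by
      rw [mem_preimage, ← h]
      exact e.mem_source.1 hz.1
    inv_toFun := ?_
    proj_inv := ?_
    continuousOn_toFun := ?_
    continuousOn_inv := ?_
    smoothAt_toFun := ?_
    smoothAt_inv := ?_ }, he₀, mem_univ _, mem_chart_source _ _⟩
  · intro x z hz h
    rw [ψ.left_inv hz.2.2, ← h, ← e.coe_fst hz.1]
    exact e.toOpenPartialHomeomorph.left_inv hz.1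
  · intro x hx y hy
    exact e.proj_symm_apply (htgt x hx _)
  · exact ψ.continuousOn.comp (continuous_snd.comp_continuousOn
      (e.continuousOn_toFun.mono inter_subset_left)) fun z hz => hz.2.2
  · refine e.toOpenPartialHomeomorph.continuousOn_symm.comp
      (f := fun q : B × X => (p q.1, ψ.symm q.2)) ?_ fun q hq => htgt _ hq.1 _
    exact (hp.continuous.comp continuous_fst).continuousOn.prodMk
      (ψ.continuousOn_symm.comp continuousOn_snd fun q hq => hq.2)
  · intro F x hF hx
    have h1 : LCSmoothAt I (LCModel.self X) (fun y => (e (F y)).2) x :=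
      (hF.comp hs e.open_source hx.1).snd
    rw [lcSmoothAt_self_iff]
    exact ⟨ContinuousAt.comp (f := fun y => (e (F y)).2) (g := ψ) (ψ.continuousAt hx.2.2) h1.1,
      h1.repr hN (chart_mem_atlas H x) (mem_chart_source H x) hψa hx.2.2⟩
  · intro h x hh hx hy
    have hc := hh.1
    have h1 : LCSmoothAt I (LCModel.self X) (fun y => ψ.symm (h y)) x := by
      refine ⟨(ψ.continuousAt_symm hy).comp hc, chartAt H x, chart_mem_atlas _ _,
        mem_chart_source _ _, ψ, hψa, ψ.map_target hy, ?_⟩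
      refine (lcSmoothAt_self_iff.1 hh).2.congr ?_
      filter_upwards [(hc.tendsto.comp ((chartAt H x).tendsto_symm_model I
        (mem_chart_source H x))).eventually_mem (ψ.open_target.mem_nhds hy)] with v hv
      exact (ψ.right_inv hv).symm
    exact ((hp.lcSmoothAt x).prodMk h1).comp hs' e.open_target (htgt x hx _)

end FibreChart

/-! ### Approximation and smoothing in one fibre chart -/

section Approximation

variable {V H W K B E M X : Type*} [NormedAddCommGroup V] [NormedSpace ℝ V]
  [FiniteDimensional ℝ V] [TopologicalSpace H] {I : ModelWithCorners ℝ V H}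
  [AddCommGroup W] [Module ℝ W] [TopologicalSpace W] [TopologicalSpace K] {J : LCModel W K}
  [TopologicalSpace B] [ChartedSpace H B] [TopologicalSpace E] [ChartedSpace K E]
  [AddCommGroup X] [Module ℝ X] [TopologicalSpace X]
  [IsTopologicalAddGroup X] [ContinuousSMul ℝ X] [LocallyConvexSpace ℝ X] [T2Space X]
  [IsManifold I ∞ B] [T2Space B] [SigmaCompactSpace B]

/-- Uniform approximation of a map on a compact set by a map which is smooth on `S` and agrees
with the given one on `A`, provided that such maps exist locally. -/
theorem exists_smooth_approx (I : ModelWithCorners ℝ V H) [IsManifold I ∞ B]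
    {f : B → X} {L A S : Set B} (hL : IsCompact L)
    (hf : ∀ a ∈ L, ContinuousAt f a) {C : Set X} (hC : Convex ℝ C) (hCo : IsOpen C) (h0 : 0 ∈ C)
    (hloc : ∀ a ∈ L, ∃ U ∈ 𝓝 a, ∃ s : B → X, ContinuousOn s U ∧ s a = f a ∧
      (∀ x ∈ U ∩ A, s x = f x) ∧ ∀ x ∈ U ∩ S, LCSmoothAt I (LCModel.self X) s x) :
    ∃ g : B → X, Continuous g ∧ (∀ x ∈ L ∩ A, g x = f x) ∧ (∀ x ∈ L, g x - f x ∈ C) ∧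
      ∀ x ∈ S, LCSmoothAt I (LCModel.self X) g x := by
  choose! U hU s hs hsa hsA hsS using hloc
  have hO : ∀ a ∈ L, interior (U a ∩ {x | s a x - f x ∈ C}) ∈ 𝓝 a := by
    intro a ha
    refine interior_mem_nhds.2 (inter_mem (hU a ha) ?_)
    have h1 : ContinuousAt (fun x => s a x - f x) a :=
      ((hs a ha).continuousAt (hU a ha)).sub (hf a ha)
    refine h1.preimage_mem_nhds (hCo.mem_nhds ?_)
    rw [hsa a ha, sub_self]
    exact h0
  obtain ⟨t, htL, ht⟩ := hL.elim_nhds_subcover _ hO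
  -- Agreement with `f` on `A` and closeness to `f` up to `C` both survive convex combinations, so
  -- the local candidates can be averaged. The weights sum to `1` only on `L`.
  obtain ⟨ρ, hρ⟩ := SmoothPartitionOfUnity.exists_isSubordinate I hL.isClosed
    (fun a : t => interior (U a ∩ {x | s a x - f x ∈ C})) (fun _ => isOpen_interior)
    (fun x hx => by simpa using ht hx)
  have hmem : ∀ (a : t) x, x ∈ tsupport (ρ a) → x ∈ interior (U a) ∧ s a x - f x ∈ C := by
    intro a x hx
    have := hρ a hx
    exact ⟨interior_mono inter_subset_left this, (interior_subset this).2⟩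
  have hmem' : ∀ (a : t) x, ρ a x ≠ 0 → x ∈ U a ∧ s a x - f x ∈ C := by
    intro a x hx
    have := hmem a x (subset_tsupport _ hx)
    exact ⟨interior_subset this.1, this.2⟩
  have hzero : ∀ (a : t) x, x ∉ tsupport (ρ a) → (fun _ => (0 : X)) =ᶠ[𝓝 x]
      fun y => ρ a y • s a y := by
    intro a x hx
    filter_upwards [(isClosed_tsupport (ρ a)).isOpen_compl.mem_nhds hx] with y hy
    rw [image_eq_zero_of_notMem_tsupport hy, zero_smul]
  have hsum : ∀ x ∈ L, ∑ a : t, ρ a x = 1 := fun x hx => by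
    rw [← finsum_eq_sum_of_fintype]
    exact ρ.sum_eq_one hx
  refine ⟨fun x => ∑ a : t, ρ a x • s a x, ?_, ?_, ?_, ?_⟩
  · refine continuous_finsetSum _ fun a _ => continuous_iff_continuousAt.2 fun x => ?_
    by_cases hx : x ∈ tsupport (ρ a)
    · exact (ρ a).contMDiff.continuous.continuousAt.smul ((hs a (htL a a.2)).continuousAt
        (mem_interior_iff_mem_nhds.1 (hmem a x hx).1))
    · exact continuousAt_const.congr (hzero a x hx)
  · intro x hx
    have : ∀ a : t, ρ a x • s a x = ρ a x • f x := by
      intro a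
      by_cases h : ρ a x = 0
      · rw [h, zero_smul, zero_smul]
      · rw [hsA a (htL a a.2) x ⟨(hmem' a x h).1, hx.2⟩]
    simp only [this, ← Finset.sum_smul, hsum x hx.1, one_smul]
  · intro x hx
    have : ∑ a : t, ρ a x • s a x - f x = ∑ᶠ a : t, ρ a x • (s a x - f x) := by
      rw [finsum_eq_sum_of_fintype]
      simp only [smul_sub, Finset.sum_sub_distrib, ← Finset.sum_smul, hsum x hx, one_smul]
    change ∑ a : t, ρ a x • s a x - f x ∈ C
    rw [this]
    exact hC.finsum_mem (fun a => ρ.nonneg a x) (ρ.sum_eq_one hx)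
      fun a ha => (hmem' a x ha).2
  · intro x hx
    refine LCSmoothAt.sum _ fun a _ => ?_
    by_cases h : x ∈ tsupport (ρ a)
    · exact LCSmoothAt.smul (ρ a).contMDiff
        (hsS a (htL a a.2) x ⟨interior_subset (hmem a x h).1, hx⟩)
    · exact (LCSmoothAt.const 0 x).congr (hzero a x h)

/-- The values of `F` on the closed set `A` extend, near each point of `A`, to a lift of `p`
which is smooth on `S`. -/
def LocallyExtends (I : ModelWithCorners ℝ V H) (J : LCModel W K) (π : E → M) (p : B → M)
    (A S : Set B) (F : B → E) : Prop :=
  ∀ a ∈ A, ∃ U ∈ 𝓝 a, ∃ s : B → E, ContinuousOn s U ∧ (∀ x ∈ U, π (s x) = p x) ∧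
    (∀ x ∈ U ∩ A, s x = F x) ∧ ∀ x ∈ U ∩ S, LCSmoothAt I J s x

/-- A lift can be smoothed in the domain of a fibre chart. -/
theorem FibreChart.exists_smoothing {π : E → M} {p : B → M} (c : FibreChart I J X π p)
    {𝒲 : Set (B × E)} (h𝒲 : IsOpen 𝒲) {F : B → E} (hF : Continuous F)
    (hFp : ∀ x, π (F x) = p x) (hF𝒲 : ∀ x, (x, F x) ∈ 𝒲) {A S : Set B} (hA : IsClosed A)
    (hext : LocallyExtends I J π p A S F)
    {χ : B → ℝ} (hχ : ContMDiff I 𝓘(ℝ, ℝ) ∞ χ) (hχ01 : ∀ x, χ x ∈ Icc (0 : ℝ) 1)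
    (hL : IsCompact (tsupport χ)) (hLc : ∀ x ∈ tsupport χ, F x ∈ c.source) :
    ∃ F' : B → E, Continuous F' ∧ (∀ x, π (F' x) = p x) ∧ (∀ x, (x, F' x) ∈ 𝒲) ∧
      (∀ x ∈ A, F' x = F x) ∧ (∀ x ∉ tsupport χ, F' x = F x) ∧
      (∀ x ∈ S, LCSmoothAt I J F x → LCSmoothAt I J F' x) ∧
      (∀ x ∈ S, χ =ᶠ[𝓝 x] 1 → LCSmoothAt I J F' x) := by
  classical
  set G : Set B := F ⁻¹' c.source with hG
  have hGo : IsOpen G := c.isOpen_source.preimage hF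
  set f : B → X := fun x => c.toFun (F x) with hf
  have hfc : ContinuousOn f G := c.continuousOn_toFun.comp hF.continuousOn fun x hx => hx
  have hfT : ∀ x ∈ G, f x ∈ c.target := fun x hx => c.mem_target _ hx
  have hdom : ∀ x ∈ G, x ∈ c.dom := fun x hx => c.mem_dom x _ hx (hFp x)
  have hfF : ∀ x ∈ G, c.inv x (f x) = F x := fun x hx => c.inv_toFun x _ hx (hFp x)
  -- Admissible perturbations: pairs `(x, y)` for which `f x + y` stays in the chart and the
  -- resulting point of `E` keeps `(x, ·)` in `𝒲`. They form an open set containing `tsupport χ ×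
  -- {0}`; the tube lemma makes the bound on `y` uniform.
  have hadd : ContinuousOn (fun q : B × X => f q.1 + q.2) (G ×ˢ univ) :=
    (hfc.comp continuousOn_fst fun q hq => hq.1).add continuousOn_snd
  have hD₀ : IsOpen ((G ×ˢ univ) ∩ (fun q : B × X => f q.1 + q.2) ⁻¹' c.target) :=
    hadd.isOpen_inter_preimage (hGo.prod isOpen_univ) c.isOpen_target
  have hinv : ContinuousOn (fun q : B × X => (q.1, c.inv q.1 (f q.1 + q.2)))
      ((G ×ˢ univ) ∩ (fun q : B × X => f q.1 + q.2) ⁻¹' c.target) := by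
    refine continuousOn_fst.prodMk (c.continuousOn_inv.comp
      (f := fun q : B × X => (q.1, f q.1 + q.2))
      (continuousOn_fst.prodMk (hadd.mono inter_subset_left)) fun q hq => ⟨hdom _ hq.1.1, hq.2⟩)
  have hD := hinv.isOpen_inter_preimage hD₀ h𝒲
  obtain ⟨u, v, -, hv, hLu, h0v, huv⟩ := generalized_tube_lemma hL (isCompact_singleton (x := (0 : X)))
    hD (by
      rintro ⟨x, y⟩ ⟨hx, hy⟩
      have hxG : x ∈ G := hLc x hx
      obtain rfl : y = 0 := hy
      refine ⟨⟨⟨hxG, mem_univ _⟩, ?_⟩, ?_⟩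
      · simpa using hfT x hxG
      · simpa [hfF x hxG] using hF𝒲 x)
  obtain ⟨C, ⟨h0C, hCo, hC⟩, hCv⟩ := (LocallyConvexSpace.convex_open_basis_zero ℝ X).mem_iff.1
    (hv.mem_nhds (h0v rfl))
  obtain ⟨g, hgc, hgA, hgC, hgS⟩ := exists_smooth_approx I hL
    (f := f) (A := A) (S := S) (fun a ha => hfc.continuousAt (hGo.mem_nhds (hLc a ha))) hC hCo h0C
    (by
      intro a ha
      -- Near `A` the prescribed local extension, read in the chart, is the candidate; off `A` a
      -- constant is enough.
      by_cases haA : a ∈ A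
      · obtain ⟨U, hU, s, hs, hsp, hsA, hsS⟩ := hext a haA
        have hsa : s a = F a := hsA a ⟨mem_of_mem_nhds hU, haA⟩
        have hsG : s ⁻¹' c.source ∈ 𝓝 a := (hs.continuousAt hU).preimage_mem_nhds
          (c.isOpen_source.mem_nhds (by rw [hsa]; exact hLc a ha))
        refine ⟨U ∩ s ⁻¹' c.source, inter_mem hU hsG, fun x => c.toFun (s x),
          c.continuousOn_toFun.comp (hs.mono inter_subset_left) fun x hx => hx.2,
          by simp only [hsa, hf], fun x hx => by simp only [hsA x ⟨hx.1.1, hx.2⟩, hf],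
          fun x hx => c.smoothAt_toFun s x (hsS x ⟨hx.1.1, hx.2⟩) hx.1.2⟩
      · exact ⟨Aᶜ, hA.isOpen_compl.mem_nhds haA, fun _ => f a, continuousOn_const, rfl,
          fun x hx => (hx.1 hx.2).elim, fun x _ => LCSmoothAt.const _ _⟩)
  -- Equal to `g` where `χ = 1` and to `f` off the support. Convexity of `C` and `0 ∈ C` keep the
  -- scaled correction admissible.
  set h : B → X := fun x => f x + χ x • (g x - f x) with hh
  have hmem : ∀ x ∈ tsupport χ, (x, χ x • (g x - f x)) ∈ u ×ˢ v := fun x hx =>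
    ⟨hLu hx, hCv (hC.smul_mem_of_zero_mem h0C (hgC x hx) (hχ01 x))⟩
  have hχ0 : ∀ x ∉ tsupport χ, χ x = 0 := fun x hx => image_eq_zero_of_notMem_tsupport hx
  have hout : ∀ x ∉ tsupport χ, h x = f x := fun x hx => by simp [hh, hχ0 x hx]
  have hhT : ∀ x ∈ G, h x ∈ c.target := by
    intro x hx
    by_cases hxL : x ∈ tsupport χ
    · exact (huv (hmem x hxL)).1.2
    · rw [hout x hxL]
      exact hfT x hx
  set F' : B → E := fun x => if x ∈ G then c.inv x (h x) else F x with hF'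
  have hF'G : ∀ x ∈ G, F' x = c.inv x (h x) := fun x hx => if_pos hx
  have hF'out : ∀ x ∉ tsupport χ, F' x = F x := by
    intro x hx
    by_cases hxG : x ∈ G
    · rw [hF'G x hxG, hout x hx, hfF x hxG]
    · exact if_neg hxG
  have hev : ∀ x ∈ G, (fun y => c.inv y (h y)) =ᶠ[𝓝 x] F' := fun x hx => by
    filter_upwards [hGo.mem_nhds hx] with y hy
    exact (hF'G y hy).symm
  have hevout : ∀ x ∉ tsupport χ, F =ᶠ[𝓝 x] F' := fun x hx => by
    filter_upwards [(isClosed_tsupport χ).isOpen_compl.mem_nhds hx] with y hy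
    exact (hF'out y hy).symm
  refine ⟨F', ?_, ?_, ?_, ?_, hF'out, ?_, ?_⟩
  · refine continuous_iff_continuousAt.2 fun x => ?_
    by_cases hx : x ∈ tsupport χ
    · have hxG := hLc x hx
      refine ContinuousAt.congr ?_ (hev x hxG)
      have hfx : ContinuousAt f x := hfc.continuousAt (hGo.mem_nhds hxG)
      have hhx : ContinuousAt (fun y => (y, h y)) x := continuousAt_id.prodMk
        (hfx.add (hχ.continuous.continuousAt.smul (hgc.continuousAt.sub hfx)))
      exact ContinuousAt.comp (f := fun y => (y, h y)) (g := fun q : B × X => c.inv q.1 q.2)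
        (c.continuousOn_inv.continuousAt ((c.isOpen_dom.prod c.isOpen_target).mem_nhds
        ⟨hdom x hxG, hhT x hxG⟩)) hhx
    · exact hF.continuousAt.congr (hevout x hx)
  · intro x
    by_cases hx : x ∈ G
    · rw [hF'G x hx]
      exact c.proj_inv x (hdom x hx) _ (hhT x hx)
    · rw [hF'out x fun h => hx (hLc x h)]
      exact hFp x
  · intro x
    by_cases hx : x ∈ tsupport χ
    · rw [hF'G x (hLc x hx)]
      exact (huv (hmem x hx)).2
    · rw [hF'out x hx]
      exact hF𝒲 x
  · intro x hx
    by_cases hxL : x ∈ tsupport χ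
    · rw [hF'G x (hLc x hxL), ← hfF x (hLc x hxL)]
      simp only [hh, hgA x ⟨hxL, hx⟩, sub_self, smul_zero, add_zero]
    · exact hF'out x hxL
  · intro x hx hsx
    by_cases hxL : x ∈ tsupport χ
    · have hxG := hLc x hxL
      have hfs : LCSmoothAt I (LCModel.self X) f x := c.smoothAt_toFun F x hsx hxG
      have hneg : ContMDiff I 𝓘(ℝ, ℝ) ∞ (fun _ : B => (-1 : ℝ)) := contMDiff_const
      have h1 : LCSmoothAt I (LCModel.self X) h x := by
        refine (hfs.add ((hgS x hx |>.add (hfs.smul hneg)).smul hχ)).congr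
          (Eventually.of_forall fun y => ?_)
        simp [hh, sub_eq_add_neg]
      exact (c.smoothAt_inv h x h1 (hdom x hxG) (hhT x hxG)).congr (hev x hxG)
    · exact hsx.congr (hevout x hxL)
  · intro x hx h1
    have hxL : x ∈ tsupport χ := subset_tsupport _ (by simp [h1.self_of_nhds])
    have hxG := hLc x hxL
    have h2 : LCSmoothAt I (LCModel.self X) h x := by
      refine (hgS x hx).congr ?_
      filter_upwards [h1] with y hy
      simp [hh, hy]
    exact (c.smoothAt_inv h x h2 (hdom x hxG) (hhT x hxG)).congr (hev x hxG)

end Approximation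

/-! ### Global smoothing by a locally finite sequence of local ones -/

section Global

variable {V H W K B E M X : Type*} [NormedAddCommGroup V] [NormedSpace ℝ V]
  [FiniteDimensional ℝ V] [TopologicalSpace H] {I : ModelWithCorners ℝ V H}
  [AddCommGroup W] [Module ℝ W] [TopologicalSpace W] [TopologicalSpace K] {J : LCModel W K}
  [TopologicalSpace B] [ChartedSpace H B] [TopologicalSpace E] [ChartedSpace K E]
  [AddCommGroup X] [Module ℝ X] [TopologicalSpace X]
  [IsTopologicalAddGroup X] [ContinuousSMul ℝ X] [LocallyConvexSpace ℝ X] [T2Space X]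
  [IsManifold I ∞ B] [T2Space B] [SigmaCompactSpace B]

/-- A continuous lift `F₀` of `p` can be replaced by one which is smooth on `S`, without changing
it on the closed set `A`, if the restriction of `F₀` to `A` has local extensions smooth on `S`. -/
theorem exists_smooth_lift {π : E → M} {p : B → M}
    (hchart : ∀ e₀ : E, ∃ c : FibreChart I J X π p, e₀ ∈ c.source)
    {F₀ : B → E} (hF₀ : Continuous F₀) (hF₀p : ∀ x, π (F₀ x) = p x) {A S : Set B}
    (hA : IsClosed A) (hext : LocallyExtends I J π p A S F₀) :
    ∃ F : B → E, Continuous F ∧ (∀ x, π (F x) = p x) ∧ (∀ x ∈ A, F x = F₀ x) ∧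
      ∀ x ∈ S, LCSmoothAt I J F x := by
  classical
  choose c hc using hchart
  obtain ⟨ι, χ, hχ⟩ := SmoothBumpCovering.exists_isSubordinate I (isClosed_univ (X := B))
    (U := fun b => F₀ ⁻¹' (c (F₀ b)).source) fun b _ =>
      hF₀.continuousAt.preimage_mem_nhds ((c (F₀ b)).isOpen_source.mem_nhds (hc _))
  have hfin : LocallyFinite fun i => tsupport (χ i) := χ.locallyFinite.closure
  have : Countable ι := countable_univ_iff.1
    (χ.locallyFinite.countable_univ fun i => (χ i).nonempty_support)
  obtain ⟨enc, henc⟩ := exists_injective_nat ι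
  -- Staying in `𝒲` means that over each `tsupport (χ i)` the lift remains in the `i`-th chart, so
  -- every later step can still be performed. Local finiteness makes `𝒲` open.
  set 𝒲 : Set (B × E) := (⋃ i, (Prod.fst ⁻¹' tsupport (χ i)) ∩
    (Prod.snd ⁻¹' (c (F₀ (χ.c i))).source)ᶜ)ᶜ with h𝒲
  have h𝒲o : IsOpen 𝒲 := by
    refine (LocallyFinite.isClosed_iUnion ?_ fun i => ?_).isOpen_compl
    · exact (hfin.preimage_continuous continuous_fst).subset fun i => inter_subset_left
    · exact ((isClosed_tsupport _).preimage continuous_fst).inter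
        ((c _).isOpen_source.preimage continuous_snd).isClosed_compl
  have h𝒲m : ∀ x e, (x, e) ∈ 𝒲 ↔ ∀ i, x ∈ tsupport (χ i) → e ∈ (c (F₀ (χ.c i))).source := by
    intro x e
    simp [h𝒲]
  let Lift := {F : B → E // Continuous F ∧ (∀ x, π (F x) = p x) ∧ (∀ x, (x, F x) ∈ 𝒲) ∧
    ∀ x ∈ A, F x = F₀ x}
  have step : ∀ (i : ι) (F : Lift), ∃ F' : Lift, (∀ x ∉ tsupport (χ i), F'.1 x = F.1 x) ∧
      (∀ x ∈ S, LCSmoothAt I J F.1 x → LCSmoothAt I J F'.1 x) ∧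
      (∀ x ∈ S, χ i =ᶠ[𝓝 x] 1 → LCSmoothAt I J F'.1 x) := by
    rintro i ⟨F, hF, hFp, hF𝒲, hFA⟩
    obtain ⟨F', h1, h2, h3, h4, h5, h6, h7⟩ := (c (F₀ (χ.c i))).exists_smoothing h𝒲o hF hFp hF𝒲 hA
      (S := S) (fun a ha => by
        obtain ⟨U, hU, s, hs1, hs2, hs3, hs4⟩ := hext a ha
        exact ⟨U, hU, s, hs1, hs2, fun x hx => (hs3 x hx).trans (hFA x hx.2).symm, hs4⟩)
      (χ i).contMDiff (fun x => ⟨(χ i).nonneg, (χ i).le_one⟩) (χ i).hasCompactSupport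
      (fun x hx => (h𝒲m x _).1 (hF𝒲 x) i hx)
    exact ⟨⟨F', h1, h2, h3, fun x hx => (h4 x hx).trans (hFA x hx)⟩, h5, h6, h7⟩
  choose next hnext1 hnext2 hnext3 using step
  let L₀ : Lift := ⟨F₀, hF₀, hF₀p, fun x => (h𝒲m x _).2 fun i hx => hχ i hx, fun _ _ => rfl⟩
  -- Stage `n` smooths in the chart whose code is `n`, and does nothing if there is none.
  let seq : ℕ → Lift := fun n => Nat.rec L₀
    (fun n F => if h : ∃ i, enc i = n then next h.choose F else F) n
  have hseq : ∀ n, seq (n + 1) = if h : ∃ i, enc i = n then next h.choose (seq n) else seq n :=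
    fun n => rfl
  have hseq1 : ∀ i, seq (enc i + 1) = next i (seq (enc i)) := by
    intro i
    have h : ∃ j, enc j = enc i := ⟨i, rfl⟩
    rw [hseq, dif_pos h, henc h.choose_spec]
  have hseq2 : ∀ n, (∃ i, enc i = n) ∨ seq (n + 1) = seq n := by
    intro n
    by_cases h : ∃ i, enc i = n
    · exact Or.inl h
    · exact Or.inr (by rw [hseq, dif_neg h])
  -- A stage changes the lift only on the support of its bump function, so near each point only
  -- finitely many stages matter.
  have hlf : LocallyFinite fun n => {x | (seq (n + 1)).1 x ≠ (seq n).1 x} := by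
    intro x
    obtain ⟨t, ht, hft⟩ := hfin x
    refine ⟨t, ht, (hft.image enc).subset ?_⟩
    rintro n ⟨y, hy, hyt⟩
    rcases hseq2 n with ⟨i, rfl⟩ | h
    · refine ⟨i, ⟨y, ?_, hyt⟩, rfl⟩
      by_contra hyi
      exact hy (by rw [hseq1, hnext1 i _ y hyi])
    · exact (hy (by rw [h])).elim
  obtain ⟨F, hF⟩ := LocallyFinite.exists_forall_eventually_atTop_eventuallyEq
    (f := fun n => (seq n).1) hlf
  refine ⟨F, continuous_iff_continuousAt.2 fun x => ?_, fun x => ?_, fun x hx => ?_,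
    fun x hx => ?_⟩
  · obtain ⟨n, hn⟩ := (hF x).exists
    exact (seq n).2.1.continuousAt.congr hn
  · obtain ⟨n, hn⟩ := (hF x).exists
    rw [← hn.self_of_nhds]
    exact (seq n).2.2.1 x
  · obtain ⟨n, hn⟩ := (hF x).exists
    rw [← hn.self_of_nhds]
    exact (seq n).2.2.2.2 x hx
  · obtain ⟨i, hi⟩ := χ.eventuallyEq_one' x (mem_univ x)
    have hsm : ∀ n, enc i + 1 ≤ n → LCSmoothAt I J (seq n).1 x := by
      intro n hn
      induction n, hn using Nat.le_induction with
      | base => rw [hseq1]; exact hnext3 i _ x hx hi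
      | succ n _ ih =>
        rcases hseq2 n with ⟨j, rfl⟩ | h
        · rw [hseq1]
          exact hnext2 j _ x hx ih
        · rwa [h]
    obtain ⟨n, hn, hn'⟩ := ((hF x).and (eventually_ge_atTop (enc i + 1))).exists
    exact (hsm n hn').congr hn

end Global

/-! ### Auxiliary facts: σ-compactness, and lifts with constant fibre coordinate -/

/-- Connected paracompact locally compact Hausdorff spaces are `σ`-compact. -/
theorem sigmaCompactSpace_of_connected (M : Type*) [TopologicalSpace M] [T2Space M]
    [ParacompactSpace M] [ConnectedSpace M] [LocallyCompactSpace M] : SigmaCompactSpace M := by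
  choose K hK hxK using fun x : M => exists_compact_mem_nhds x
  obtain ⟨v, hvo, hvc, hvf, hvK⟩ := precise_refinement (fun x => interior (K x))
    (fun x => isOpen_interior) (eq_univ_of_forall fun x =>
      mem_iUnion.2 ⟨x, mem_interior_iff_mem_nhds.2 (hxK x)⟩)
  have hcc : ∀ x, IsCompact (closure (v x)) := fun x =>
    (hK x).closure_of_subset ((hvK x).trans interior_subset)
  -- A compact set meets finitely many members of the cover, whose closures are compact.
  have hnext : ∀ L : Set M, IsCompact L → ∃ L' : Set M, IsCompact L' ∧
      ∀ x, (v x ∩ L).Nonempty → v x ⊆ L' := by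
    intro L hL
    have hfin := hvf.finite_nonempty_inter_compact hL
    exact ⟨⋃ x ∈ {x | (v x ∩ L).Nonempty}, closure (v x), hfin.isCompact_biUnion fun x _ => hcc x,
      fun x hx => subset_closure.trans (subset_biUnion_of_mem (u := fun x => closure (v x))
        (show x ∈ {x | (v x ∩ L).Nonempty} from hx))⟩
  choose! N hN hNv using hnext
  obtain ⟨x₀⟩ := (inferInstance : Nonempty M)
  let L : ℕ → Set M := fun n => Nat.rec {x₀} (fun _ L => N L) n
  have hL : ∀ n, IsCompact (L n) := by
    intro n
    induction n with
    | zero => exact isCompact_singleton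
    | succ n ih => exact hN _ ih
  have hLv : ∀ n x, (v x ∩ L n).Nonempty → v x ⊆ L (n + 1) := fun n => hNv _ (hL n)
  have hcov : ∀ y, ∃ x, y ∈ v x := fun y => mem_iUnion.1 (hvc ▸ mem_univ y)
  -- A member of the cover that meets the union is contained in it.
  have hclopen : IsClopen (⋃ n, L n) := by
    constructor
    · rw [← isOpen_compl_iff, isOpen_iff_mem_nhds]
      intro y hy
      obtain ⟨x, hx⟩ := hcov y
      refine mem_of_superset ((hvo x).mem_nhds hx) fun z hz hz' => hy ?_
      obtain ⟨n, hn⟩ := mem_iUnion.1 hz'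
      exact mem_iUnion.2 ⟨n + 1, hLv n x ⟨z, hz, hn⟩ hx⟩
    · rw [isOpen_iff_mem_nhds]
      intro y hy
      obtain ⟨n, hn⟩ := mem_iUnion.1 hy
      obtain ⟨x, hx⟩ := hcov y
      exact mem_of_superset ((hvo x).mem_nhds hx)
        ((hLv n x ⟨y, hx, hn⟩).trans (subset_iUnion L (n + 1)))
  have huniv := hclopen.eq_univ ⟨x₀, mem_iUnion.2 ⟨0, rfl⟩⟩
  exact ⟨⟨L, hL, huniv⟩⟩

/-- The fibre coordinate of `e₀` is kept constant. The value is then `e₀` at all points with the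
same image under `p`; on the cylinder this is a whole line in the time direction, as base-point
preservation requires. -/
theorem FibreChart.exists_local_lift {V H W K B E M X : Type*} [NormedAddCommGroup V]
    [NormedSpace ℝ V] [FiniteDimensional ℝ V] [TopologicalSpace H] {I : ModelWithCorners ℝ V H}
    [AddCommGroup W] [Module ℝ W] [TopologicalSpace W] [TopologicalSpace K] {J : LCModel W K}
    [TopologicalSpace B] [ChartedSpace H B] [TopologicalSpace E] [ChartedSpace K E]
    [AddCommGroup X] [Module ℝ X] [TopologicalSpace X]
    [IsTopologicalAddGroup X] [ContinuousSMul ℝ X] [LocallyConvexSpace ℝ X] [T2Space X]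
    [IsManifold I ∞ B] {π : E → M} {p : B → M} (c : FibreChart I J X π p) {e₀ : E}
    (he₀ : e₀ ∈ c.source) {b : B} (hb : π e₀ = p b) :
    ∃ U ∈ 𝓝 b, ∃ s : B → E, ContinuousOn s U ∧ (∀ x ∈ U, π (s x) = p x) ∧
      (∀ x, p x = p b → s x = e₀) ∧ ∀ x ∈ U, LCSmoothAt I J s x := by
  refine ⟨c.dom, c.isOpen_dom.mem_nhds (c.mem_dom b e₀ he₀ hb), fun x => c.inv x (c.toFun e₀),
    ?_, fun x hx => c.proj_inv x hx _ (c.mem_target _ he₀),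
    fun x hx => c.inv_toFun x e₀ he₀ (hb.trans hx.symm),
    fun x hx => c.smoothAt_inv _ x (LCSmoothAt.const _ _) hx (c.mem_target _ he₀)⟩
  exact c.continuousOn_inv.comp (f := fun x => (x, c.toFun e₀)) (by fun_prop)
    fun x hx => ⟨hx, c.mem_target _ he₀⟩

/-! ### Application to the cylinder `[0,1] × M` -/

section Homotopy

/-- The model with corners of `[0,1] × M`. -/
abbrev cylinderModel (d : ℕ) := (𝓡∂ 1).prod (modelWithCornersEuclideanQuadrant d)

variable {d : ℕ} {M N E X : Type*}
    [TopologicalSpace M] [T2Space M] [SigmaCompactSpace M]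
    [ChartedSpace (EuclideanQuadrant d) M]
    [IsManifold (modelWithCornersEuclideanQuadrant d) ∞ M]
    [AddCommGroup X] [Module ℝ X] [TopologicalSpace X] [IsTopologicalAddGroup X]
    [ContinuousSMul ℝ X] [LocallyConvexSpace ℝ X] [T2Space X]
    [TopologicalSpace N] [ChartedSpace X N]
    [TopologicalSpace E] [ChartedSpace (ModelProd (EuclideanQuadrant d) X) E]
    {π : E → M}

theorem IsSmoothBundle.exists_cylinderChart
    (hN : IsLCManifold (LCModel.self X) N) (hπ : IsSmoothBundle d X N π) (e₀ : E) :
    ∃ c : FibreChart (cylinderModel d) (totalModel d X) X π (Prod.snd : unitInterval × M → M),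
      e₀ ∈ c.source :=
  hπ.exists_fibreChart hN (cylinderModel d) contMDiff_snd e₀

theorem isOpen_setOf_fst_lt (r : ℝ) : IsOpen {q : unitInterval × M | (q.1 : ℝ) < r} :=
  isOpen_lt (by fun_prop) continuous_const

theorem isOpen_setOf_lt_fst (r : ℝ) : IsOpen {q : unitInterval × M | r < (q.1 : ℝ)} :=
  isOpen_lt continuous_const (by fun_prop)

/-- A continuous section is homotopic, relative to a set with at most one point, to a smooth one. -/
theorem exists_homotopy_smooth_section (hN : IsLCManifold (LCModel.self X) N)
    (hE : IsLCManifold (totalModel d X) E) (hπ : IsSmoothBundle d X N π)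
    {P : Set M} (hP : P.Subsingleton) {σ : M → E} (hσ : Continuous σ) (hσs : IsSection π σ) :
    ∃ τ : M → E, IsSmoothInto d X τ ∧ IsSection π τ ∧ (∀ x ∈ P, τ x = σ x) ∧
      ∃ F : unitInterval × M → E, IsSectionHomotopy π σ τ F ∧ ∀ t, ∀ x ∈ P, F (t, x) = σ x := by
  obtain ⟨F, hF, hFp, hFA, hFS⟩ := exists_smooth_lift (I := cylinderModel d)
    (J := totalModel d X) (X := X) (π := π) (p := (Prod.snd : unitInterval × M → M))
    (hπ.exists_cylinderChart hN) (F₀ := fun q => σ q.2) (hσ.comp continuous_snd)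
    (fun q => hσs q.2) (A := {q | q.1 = 0} ∪ {q | q.2 ∈ P}) (S := {q | 1 / 2 < (q.1 : ℝ)})
    ((isClosed_eq continuous_fst continuous_const).union
      (hP.isClosed.preimage continuous_snd)) (by
      rintro ⟨t, m⟩ ha
      -- For `t < 1/2` nothing need be smooth, so the merely continuous `σ` is its own extension.
      -- Otherwise the point lies over `P`, and the neighbourhood is cut down to avoid `t = 0`.
      by_cases ht : (t : ℝ) < 1 / 2
      · refine ⟨_, (isOpen_setOf_fst_lt (1 / 2)).mem_nhds ht, fun q => σ q.2,
          (hσ.comp continuous_snd).continuousOn, fun q _ => hσs q.2, fun _ _ => rfl,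
          fun q hq => ?_⟩
        have h1 : (q.1 : ℝ) < 1 / 2 := hq.1
        have h2 : 1 / 2 < (q.1 : ℝ) := hq.2
        exact (lt_asymm h1 h2).elim
      · have ht0 : (0 : ℝ) < t := by linarith
        have hm : m ∈ P := ha.resolve_left fun h => by
          rw [show t = 0 from h] at ht0
          simp at ht0
        obtain ⟨c, hc⟩ := hπ.exists_cylinderChart hN (σ m)
        obtain ⟨U, hU, s, hs1, hs2, hs3, hs4⟩ := c.exists_local_lift hc (b := (t, m)) (hσs m)
        refine ⟨U ∩ {q | 0 < (q.1 : ℝ)}, inter_mem hU ((isOpen_setOf_lt_fst 0).mem_nhds ht0), s,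
          hs1.mono inter_subset_left, fun q hq => hs2 q hq.1, ?_, fun q hq => hs4 q hq.1.1⟩
        rintro q ⟨⟨_, hq0⟩, hq⟩
        have hqP : q.2 ∈ P := hq.resolve_left fun h => by
          have h0 : (0 : ℝ) < q.1 := hq0
          rw [show q.1 = 0 from h] at h0
          simp at h0
        have hqm : q.2 = m := hP hqP hm
        exact (hs3 q hqm).trans (by rw [← hqm]))
  have hτ : ∀ x, LCSmoothAt (modelWithCornersEuclideanQuadrant d) (totalModel d X)
      (fun x => F (1, x)) x := fun x =>
    LCSmoothAt.comp_contMDiff (I := cylinderModel d) (f := fun x : M => ((1 : unitInterval), x))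
      (contMDiff_const.prodMk contMDiff_id) (hFS (1, x) (by
        change (1 / 2 : ℝ) < ((1 : unitInterval) : ℝ)
        norm_num))
  have hPF : ∀ t, ∀ x ∈ P, F (t, x) = σ x := fun t x hx => hFA (t, x) (Or.inr hx)
  exact ⟨fun x => F (1, x), LCSmoothAt.lcSmoothMapOn hE isOpen_univ fun x _ => hτ x,
    fun x => hFp (1, x), hPF 1, F, ⟨hF, fun t x => hFp (t, x), fun x => hFA (0, x) (Or.inl rfl),
      fun _ => rfl⟩, hPF⟩

theorem IsSmoothInto.lcSmoothAt_comp_snd {σ : M → E} (hσ : IsSmoothInto d X σ)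
    (q : unitInterval × M) :
    LCSmoothAt (cylinderModel d) (totalModel d X) (fun q : unitInterval × M => σ q.2) q := by
  have h : LCSmoothAt (cylinderModel d) (quadrantModel d) (Prod.snd : unitInterval × M → M) q :=
    (contMDiff_snd (I := 𝓡∂ 1) (J := modelWithCornersEuclideanQuadrant d)).lcSmoothAt q
  exact h.comp hσ isOpen_univ (mem_univ _)

/-- A homotopy between smooth sections, relative to a set with at most one point, can be replaced
by a smooth one. -/
theorem exists_smooth_homotopy (hN : IsLCManifold (LCModel.self X) N)
    (hE : IsLCManifold (totalModel d X) E) (hπ : IsSmoothBundle d X N π)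
    {P : Set M} (hP : P.Subsingleton) {σ τ : M → E} (hσ : IsSmoothInto d X σ)
    (hσs : IsSection π σ) (hτ : IsSmoothInto d X τ) (hτs : IsSection π τ)
    {F₀ : unitInterval × M → E} (hF₀ : IsSectionHomotopy π σ τ F₀)
    (hF₀P : ∀ t, ∀ x ∈ P, F₀ (t, x) = σ x) :
    ∃ F : unitInterval × M → E, IsSectionHomotopy π σ τ F ∧ IsSmoothHomotopy d X F ∧
      ∀ t, ∀ x ∈ P, F (t, x) = σ x := by
  have hστ : ∀ x ∈ P, τ x = σ x := fun x hx => by rw [← hF₀.one x, hF₀P 1 x hx]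
  obtain ⟨F, hF, hFp, hFA, hFS⟩ := exists_smooth_lift (I := cylinderModel d)
    (J := totalModel d X) (X := X) (π := π) (p := (Prod.snd : unitInterval × M → M))
    (hπ.exists_cylinderChart hN) hF₀.continuous (fun q => hF₀.isSection q.1 q.2)
    (A := {q | q.1 = 0} ∪ {q | q.1 = 1} ∪ {q | q.2 ∈ P}) (S := univ)
    (((isClosed_eq continuous_fst continuous_const).union
      (isClosed_eq continuous_fst continuous_const)).union
      (hP.isClosed.preimage continuous_snd)) (by
      rintro ⟨t, m⟩ ha
      -- Near `t = 0` extend by `σ`, near `t = 1` by `τ`, both constant in time. In between only the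
      -- line over `P` belongs to `A`, and a local lift constant on it serves.
      rcases eq_or_lt_of_le t.2.1 with ht0 | ht0
      · refine ⟨_, (isOpen_setOf_fst_lt 1).mem_nhds
          (show (t : ℝ) < 1 by rw [← ht0]; exact zero_lt_one), fun q => σ q.2,
          (hσ.1.comp continuousOn_snd (mapsTo_univ _ _)).mono (fun q _ => mem_univ q.2),
          fun q _ => hσs q.2, ?_, fun q _ => hσ.lcSmoothAt_comp_snd q⟩
        rintro ⟨r, x⟩ ⟨hr1, (h | h) | h⟩
        · obtain rfl : r = 0 := h
          exact (hF₀.zero x).symm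
        · obtain rfl : r = 1 := h
          simp at hr1
        · exact (hF₀P r x h).symm
      rcases eq_or_lt_of_le t.2.2 with ht1 | ht1
      · refine ⟨_, (isOpen_setOf_lt_fst 0).mem_nhds ht0, fun q => τ q.2,
          (hτ.1.comp continuousOn_snd (mapsTo_univ _ _)).mono (fun q _ => mem_univ q.2),
          fun q _ => hτs q.2, ?_, fun q _ => hτ.lcSmoothAt_comp_snd q⟩
        rintro ⟨r, x⟩ ⟨hr0, (h | h) | h⟩
        · obtain rfl : r = 0 := h
          simp at hr0
        · obtain rfl : r = 1 := h
          exact (hF₀.one x).symm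
        · exact (hστ x h).trans (hF₀P r x h).symm
      · have hne : ∀ r : unitInterval, 0 < (r : ℝ) → (r : ℝ) < 1 → ¬ (r = 0 ∨ r = 1) := by
          rintro r h0 h1 (rfl | rfl)
          · simp at h0
          · simp at h1
        have hm : m ∈ P := ha.resolve_left (hne t ht0 ht1)
        obtain ⟨c, hc⟩ := hπ.exists_cylinderChart hN (σ m)
        obtain ⟨U, hU, s, hs1, hs2, hs3, hs4⟩ := c.exists_local_lift hc (b := (t, m)) (hσs m)
        refine ⟨U ∩ ({q | 0 < (q.1 : ℝ)} ∩ {q | (q.1 : ℝ) < 1}), inter_mem hU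
          (((isOpen_setOf_lt_fst 0).inter (isOpen_setOf_fst_lt 1)).mem_nhds ⟨ht0, ht1⟩), s,
          hs1.mono inter_subset_left, fun q hq => hs2 q hq.1, ?_, fun q hq => hs4 q hq.1.1⟩
        rintro ⟨r, x⟩ ⟨⟨_, hr0, hr1⟩, hq⟩
        have hxP : x ∈ P := hq.resolve_left (hne r hr0 hr1)
        obtain rfl : x = m := hP hxP hm
        exact (hs3 (r, x) rfl).trans (hF₀P r x hxP).symm)
  refine ⟨F, ⟨hF, fun t x => hFp (t, x), fun x => ?_, fun x => ?_⟩,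
    LCSmoothAt.lcSmoothMapOn (I := cylinderModel d) hE isOpen_univ fun q _ => hFS q (mem_univ _),
    fun t x hx => ?_⟩
  · rw [hFA (0, x) (Or.inl (Or.inl rfl)), hF₀.zero]
  · rw [hFA (1, x) (Or.inl (Or.inr rfl)), hF₀.one]
  · rw [hFA (t, x) (Or.inr hx), hF₀P t x hx]

end Homotopy

end

theorem mainTheorem3 (d : ℕ) {M N E X : Type*}
    [TopologicalSpace M] [T2Space M] [ParacompactSpace M] [ConnectedSpace M]
    [ChartedSpace (EuclideanQuadrant d) M]
    [IsManifold (modelWithCornersEuclideanQuadrant d) ∞ M]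
    [AddCommGroup X] [Module ℝ X] [TopologicalSpace X] [IsTopologicalAddGroup X]
    [ContinuousSMul ℝ X] [LocallyConvexSpace ℝ X] [T2Space X]
    [TopologicalSpace N] [T2Space N] [ChartedSpace X N]
    (hN : IsLCManifold (LCModel.self X) N)
    [TopologicalSpace E] [ChartedSpace (ModelProd (EuclideanQuadrant d) X) E]
    (hE : IsLCManifold (totalModel d X) E)
    (π : E → M) (hπ : IsSmoothBundle d X N π) :
    (∀ σ : M → E, Continuous σ → IsSection π σ →
      ∃ τ : M → E, IsSmoothInto d X τ ∧ IsSection π τ ∧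
        ∃ F : unitInterval × M → E, IsSectionHomotopy π σ τ F) ∧
    (∀ σ τ : M → E, IsSmoothInto d X σ → IsSection π σ → IsSmoothInto d X τ → IsSection π τ →
      (∃ F : unitInterval × M → E, IsSectionHomotopy π σ τ F) →
      ∃ F : unitInterval × M → E, IsSectionHomotopy π σ τ F ∧ IsSmoothHomotopy d X F) ∧
    (∀ (x₀ : M) (e₀ : E), π e₀ = x₀ →
      (∀ σ : M → E, Continuous σ → IsSection π σ → σ x₀ = e₀ →
        ∃ τ : M → E, IsSmoothInto d X τ ∧ IsSection π τ ∧ τ x₀ = e₀ ∧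
          ∃ F : unitInterval × M → E, IsSectionHomotopy π σ τ F ∧ ∀ t, F (t, x₀) = e₀) ∧
      (∀ σ τ : M → E, IsSmoothInto d X σ → IsSection π σ → IsSmoothInto d X τ →
        IsSection π τ → σ x₀ = e₀ → τ x₀ = e₀ →
        (∃ F : unitInterval × M → E, IsSectionHomotopy π σ τ F ∧ ∀ t, F (t, x₀) = e₀) →
        ∃ F : unitInterval × M → E, IsSectionHomotopy π σ τ F ∧ IsSmoothHomotopy d X F ∧
          ∀ t, F (t, x₀) = e₀)) := by
  have : LocallyCompactSpace M :=
    Manifold.locallyCompact_of_finiteDimensional (modelWithCornersEuclideanQuadrant d)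
  -- Connectedness enters here: σ-compactness makes bump coverings countable. The set `P` kept fixed
  -- is then empty for the free statements and `{x₀}` for the pointed ones.
  have : SigmaCompactSpace M := sigmaCompactSpace_of_connected M
  refine ⟨fun σ hσ hσs => ?_, fun σ τ hσ hσs hτ hτs ⟨F, hF⟩ => ?_, fun x₀ e₀ _ =>
    ⟨fun σ hσ hσs hσ₀ => ?_, fun σ τ hσ hσs hτ hτs hσ₀ _ ⟨F, hF, hF₀⟩ => ?_⟩⟩
  · obtain ⟨τ, h1, h2, -, F, h3, -⟩ :=
      exists_homotopy_smooth_section hN hE hπ subsingleton_empty hσ hσs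
    exact ⟨τ, h1, h2, F, h3⟩
  · obtain ⟨F', h1, h2, -⟩ := exists_smooth_homotopy hN hE hπ subsingleton_empty hσ hσs hτ hτs hF
      fun _ _ h => h.elim
    exact ⟨F', h1, h2⟩
  · obtain ⟨τ, h1, h2, h3, F, h4, h5⟩ :=
      exists_homotopy_smooth_section hN hE hπ (subsingleton_singleton (a := x₀)) hσ hσs
    exact ⟨τ, h1, h2, (h3 x₀ rfl).trans hσ₀, F, h4, fun t => (h5 t x₀ rfl).trans hσ₀⟩
  · obtain ⟨F', h1, h2, h3⟩ := exists_smooth_homotopy hN hE hπ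
      (subsingleton_singleton (a := x₀)) hσ hσs hτ hτs hF fun t x hx => by
        rw [show x = x₀ from hx, hF₀, hσ₀]
    exact ⟨F', h1, h2, fun t => (h3 t x₀ rfl).trans hσ₀⟩
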